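/- **Setting.** Let $d\ge 2$. A fully connected ReLU network with $d$ layers of widths $h_0,h_1,\dots,h_d$ is a parameter $\theta=(A_1,\dots,A_d)\in\Theta=\mathbb R^{h_1\times h_0}\times\cdots\times\mathbb R^{h_d\times h_{d-1}}$. With $\phi$ the coordinatewise ReLU, an input $x$ gives the vectors before activation $x^0=x$, $x^1=A_1x^0$, $x^i=A_i\phi(x^{i-1})$ for $2\le i\le d$, and $f_\theta(x)=x^d$. For $1\le i\le j\le d$ let $M^{i,j}$ be the composition of the layers $i+1,\dots,j$ (so $x^j=M^{i,j}(x^i)$) and $J^{i,j}_{x^i}$ its Jacobian at $x^i$. Let $S\subset\mathbb R^{h_0}\times\mathbb R^{h_d}$ be a finite non-empty sample and $L(f_\theta)=\frac1{|S|}\sum_{(x,y)\in S}l(y,f_\theta(x))$, where $l(y,\hat y)$ is convex and $\beta$-Lipschitz in $\hat y$. Norms of vectors are $\ell_2$ norms, $\|\cdot\|$ of a matrix is the operator norm, $\|\cdot\|_F$ the Frobenius norm; $h_{\min}=\min_{1\le i\le d-1}h_i$; "$x\in S$" ranges over the inputs in $S$. **Noise stability quantities.** $$\mu_i=\min_{x\in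 S}\frac{\|A_i\phi(x^{i-1})\|}{\|A_i\|_F\|\phi(x^{i-1})\|},\qquad \mu_{i,j}=\min_{x\in S}\frac{\|J^{i,j}_{x^i}x^i\|}{\|J^{i,j}_{x^i}\|\,\|x^i\|},\qquad \mu_{i\to}=\min_{i\le j\le d}\mu_{i,j},\qquad c=\max_{x\in S,\,1\le i\le d-1}\frac{\|x^i\|}{\|\phi(x^i)\|}$$ (layer cushion, interlayer cushion, minimal interlayer cushion, activation contraction). **Dropout.** Let $p=3/4$. Independently for every $2\le i\le d$ and every column of $A_i$, multiply this column by $0$ with probability $p$ and by $\frac1{1-p}$ with probability $1-p$; this gives $\hat A_i$. Put $\theta^i=(A_1,\hat A_2,\dots,\hat A_i,A_{i+1},\dots,A_d)$ (so $\theta^1=\theta$), and for $0\le t\le1$ let $\hat x^i_m(t)$ be the vector before activation at layer $i$, on input $x$, of the network $t\theta+(1-t)\theta^m$. **Definition.** Let $K$ be a constant. The network $\theta$ is $\epsilon$-noise stable (with constant $K$) if $\min_{2\le i\le d}\mu_i\mu_{i\to}$ is well defined (all Jacobians in it exist and all denominators are nonzero) and positive; for some $\rho\ge 3d$ the following hold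 simultaneously with probability at least $1/2$ over the dropout: * (interlayer smoothness $\rho$) for all $2\le i\le j\le d$, $x\in S$, $0\le t\le 1$, both for $\hat x=\hat x^i_i(t)$ and for $\hat x=\hat x^i_{i-1}(t)$, $$\|M^{i,j}(\hat x)-J^{i,j}_{x^i}\hat x\|\le\frac{\|\hat x-x^i\|\,\|x^j\|}{\rho\,\|x^i\|};$$ * for all $1\le i\le d-1$, $x\in S$, $0\le t\le1$: $\ \|\phi(\hat x^i_i(t))\|_\infty\le\frac{K}{\sqrt{h_i}}\|\phi(\hat x^i_i(t))\|$; and $$\frac{\beta\,c\,d^{3/2}\max_{x\in S}\|f_\theta(x)\|}{h_{\min}^{1/2}\,\min_{2\le i\le d}(\mu_i\mu_{i\to})}\le\epsilon .$$ **Theorem.** There is an absolute $k\in\mathbb N$, and for every $K$ a constant $C$ depending only on $K$, such that the following holds for all $d\ge2$, all widths, samples $S$, constants $\beta$, losses $l$ as above and all $\epsilon$. If $\theta^A$ and $\theta^B$ are both $\epsilon$-noise stable (with constant $K$), then there is a continuous path $\pi:[0,1]\to\Theta$ from $\theta^A$ to $\theta^B$ consisting of $10$ line segments such that for all $0\le t\le1$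 $$L(f_{\pi(t)})\le\max\{L(f_{\theta^A}),L(f_{\theta^B})\}+C\,\log\Bigl(2+|S|+d+\sum_{i=1}^d h_i\Bigr)^{k}\,\epsilon .$$ -/

import Mathlib

open Set MeasureTheory

noncomputable section

namespace NoiseStability

/-- Euclidean space `ℝⁿ`, with the `ℓ²` norm. -/
abbrev Vec (n : ℕ) : Type := EuclideanSpace ℝ (Fin n)

/-- The parameter space of fully connected networks with `d` layers and widths `h 0, …, h d`:
`θ n` is the weight matrix `A_{n+1} ∈ ℝ^{h (n+1) × h n}` of layer `n + 1`, for `0 ≤ n < d`. -/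
abbrev Params (d : ℕ) (h : ℕ → ℕ) : Type :=
  (n : Fin d) → Matrix (Fin (h (n.val + 1))) (Fin (h n.val)) ℝ

/-- The coordinatewise ReLU activation `φ`. -/
def relu {n : ℕ} (v : Vec n) : Vec n := WithLp.toLp 2 fun a => max (v a) 0

/-- The matrix-vector product, as a vector of Euclidean space. -/
def apply {m n : ℕ} (A : Matrix (Fin m) (Fin n) ℝ) (v : Vec n) : Vec m :=
  WithLp.toLp 2 (A.mulVec (WithLp.ofLp v))

/-- The Frobenius norm. -/
def frobeniusNorm {m n : ℕ} (A : Matrix (Fin m) (Fin n) ℝ) : ℝ :=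
  Real.sqrt (∑ a, ∑ b, A a b ^ 2)

section Network

variable {d : ℕ} {h : ℕ → ℕ}

/-- The weight matrix `A_{n+1}` of layer `n + 1`, indexed by natural numbers `n`
(the value `0` for `n ≥ d` is never used). -/
def weight (θ : Params d h) (n : ℕ) : Matrix (Fin (h (n + 1))) (Fin (h n)) ℝ :=
  if hn : n < d then θ ⟨n, hn⟩ else 0

/-- The vector `x^i` before activation at layer `i` on input `x`:
`x^0 = x`, `x^1 = A_1 x^0`, and `x^i = A_i φ(x^{i-1})` for `i ≥ 2`. -/
def preact (θ : Params d h) (x : Vec (h 0)) : (i : ℕ) → Vec (h i)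
  | 0 => x
  | 1 => apply (weight θ 0) x
  | n + 2 => apply (weight θ (n + 1)) (relu (preact θ x (n + 1)))

/-- The function `f_θ` computed by the network: the output is `x^d`. -/
def output (θ : Params d h) (x : Vec (h 0)) : Vec (h d) := preact θ x d

/-- The composition `M^{i,j}` of the layers `i + 1, …, j`, where `j = i + k` and `i ≥ 1`,
so that `x^j = M^{i,j}(x^i)`. -/
def layers (θ : Params d h) (i : ℕ) : (k : ℕ) → Vec (h i) → Vec (h (i + k))
  | 0 => fun v => v
  | k + 1 => fun v => apply (weight θ (i + k)) (relu (layers θ i k v))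

/-- The Jacobian `J^{i,j}_{x^i}` of `M^{i,j}` at `x^i`, where `j = i + k`. As a continuous linear
map its norm is the spectral norm. -/
def jacobian (θ : Params d h) (x : Vec (h 0)) (i k : ℕ) : Vec (h i) →L[ℝ] Vec (h (i + k)) :=
  fderiv ℝ (layers θ i k) (preact θ x i)

/-- The empirical loss `L(f_θ) = (1/|S|) ∑_{(x,y) ∈ S} l(y, f_θ(x))`. -/
def loss (l : Vec (h d) → Vec (h d) → ℝ) (S : Finset (Vec (h 0) × Vec (h d)))
    (θ : Params d h) : ℝ :=
  (S.card : ℝ)⁻¹ * ∑ z ∈ S, l z.2 (output θ z.1)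

/-! ### Noise stability quantities -/

/-- The layer cushion `μ_{n+1}` of layer `n + 1`, for `n ≥ 1`:
the minimum over the sample of `‖A_{n+1} φ(x^n)‖ / (‖A_{n+1}‖_F ‖φ(x^n)‖)`. -/
def layerCushion (θ : Params d h) (S : Finset (Vec (h 0) × Vec (h d))) (n : ℕ) : ℝ :=
  ⨅ z : S, ‖apply (weight θ n) (relu (preact θ z.1.1 n))‖ /
    (frobeniusNorm (weight θ n) * ‖relu (preact θ z.1.1 n)‖)

/-- The interlayer cushion `μ_{i,j}`, where `j = i + k`: the minimum over the sample of
`‖J^{i,j}_{x^i} x^i‖ / (‖J^{i,j}_{x^i}‖ ‖x^i‖)`. -/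
def interlayerCushion (θ : Params d h) (S : Finset (Vec (h 0) × Vec (h d))) (i k : ℕ) : ℝ :=
  ⨅ z : S, ‖jacobian θ z.1.1 i k (preact θ z.1.1 i)‖ /
    (‖jacobian θ z.1.1 i k‖ * ‖preact θ z.1.1 i‖)

/-- The minimal interlayer cushion `μ_{i→} = min_{i ≤ j ≤ d} μ_{i,j}` of a layer `i ≤ d`. -/
def minInterlayerCushion (θ : Params d h) (S : Finset (Vec (h 0) × Vec (h d))) (i : ℕ) : ℝ :=
  ⨅ k : Fin (d - i + 1), interlayerCushion θ S i k.val

/-- `min_{2 ≤ i ≤ d} μ_i μ_{i→}` (here `i = n + 2`). -/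
def minCushion (θ : Params d h) (S : Finset (Vec (h 0) × Vec (h d))) : ℝ :=
  ⨅ n : Fin (d - 1), layerCushion θ S (n.val + 1) * minInterlayerCushion θ S (n.val + 2)

/-- The activation contraction `c = max_{x ∈ S, 1 ≤ i ≤ d - 1} ‖x^i‖ / ‖φ(x^i)‖`
(here `i = n + 1`). -/
def activationContraction (θ : Params d h) (S : Finset (Vec (h 0) × Vec (h d))) : ℝ :=
  ⨆ q : S × Fin (d - 1), ‖preact θ q.1.1.1 (q.2.val + 1)‖ / ‖relu (preact θ q.1.1.1 (q.2.val + 1))‖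

/-- `max_{x ∈ S} ‖f_θ(x)‖`. -/
def maxOutput (θ : Params d h) (S : Finset (Vec (h 0) × Vec (h d))) : ℝ :=
  ⨆ z : S, ‖output θ z.1.1‖

/-- The minimum width `h_min` of the hidden layers `1, …, d - 1`. -/
def minWidth (d : ℕ) (h : ℕ → ℕ) : ℕ := ⨅ n : Fin (d - 1), h (n.val + 1)

/-- The single number measuring the noise stability of the network,
`β c d^{3/2} max_{x ∈ S} ‖f_θ(x)‖ / (h_min^{1/2} min_{2 ≤ i ≤ d} μ_i μ_{i→})`. -/
def noiseLevel (β : ℝ) (θ : Params d h) (S : Finset (Vec (h 0) × Vec (h d))) : ℝ :=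
  β * activationContraction θ S * (d : ℝ) ^ (3 / 2 : ℝ) * maxOutput θ S /
    (Real.sqrt (minWidth d h) * minCushion θ S)

/-! ### The dropout procedure -/

/-- The outcomes of the dropout procedure: `ω n b = true` means that column `b` of the matrix
`A_{n+1}` is dropped. -/
abbrev Mask (d : ℕ) (h : ℕ → ℕ) : Type := (n : Fin d) → Fin (h n.val) → Bool

/-- The law of the dropout procedure with dropout probability `p`: all columns are dropped
independently, each with probability `p`. -/
def dropoutLaw (d : ℕ) (h : ℕ → ℕ) (p : unitInterval) : Measure (Mask d h) :=
  Measure.pi fun _ => Measure.pi fun _ => ProbabilityTheory.bernoulliMeasure true false p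

/-- The network `θ^i = (A_1, Â_2, …, Â_i, A_{i+1}, …, A_d)`, where `Â_m` is `A_m` with the dropped
columns multiplied by `0` and the others by `1 / (1 - p)`. The first matrix is never changed. -/
def dropout (p : unitInterval) (θ : Params d h) (ω : Mask d h) (i : ℕ) : Params d h :=
  fun n => Matrix.of fun a b =>
    if 1 ≤ n.val ∧ n.val + 1 ≤ i then
      (if ω n b = true then 0 else 1 / (1 - (p : ℝ))) * θ n a b
    else θ n a b

/-- The vector `x̂^i_m(t)` before activation at layer `i`, on input `x`, of the network with
parameters `t θ + (1 - t) θ^m`. -/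
def noisyPreact (p : unitInterval) (θ : Params d h) (ω : Mask d h) (m : ℕ) (t : ℝ)
    (x : Vec (h 0)) (i : ℕ) : Vec (h i) :=
  preact (t • θ + (1 - t) • dropout p θ ω m) x i

/-- The outcomes of the dropout procedure for which the two inequalities of interlayer smoothness
hold with the number `ρ`, for all layers `2 ≤ i ≤ j ≤ d` (with `j = i + k`), all samples and all
`0 ≤ t ≤ 1`. -/
def smoothEvent (p : unitInterval) (θ : Params d h) (S : Finset (Vec (h 0) × Vec (h d)))
    (ρ : ℝ) : Set (Mask d h) :=
  {ω | ∀ i k : ℕ, 2 ≤ i → i + k ≤ d → ∀ z ∈ S, ∀ t ∈ Icc (0 : ℝ) 1,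
    ‖layers θ i k (noisyPreact p θ ω i t z.1 i)
        - jacobian θ z.1 i k (noisyPreact p θ ω i t z.1 i)‖
      ≤ ‖noisyPreact p θ ω i t z.1 i - preact θ z.1 i‖ * ‖preact θ z.1 (i + k)‖
          / (ρ * ‖preact θ z.1 i‖) ∧
    ‖layers θ i k (noisyPreact p θ ω (i - 1) t z.1 i)
        - jacobian θ z.1 i k (noisyPreact p θ ω (i - 1) t z.1 i)‖
      ≤ ‖noisyPreact p θ ω (i - 1) t z.1 i - preact θ z.1 i‖ * ‖preact θ z.1 (i + k)‖
          / (ρ * ‖preact θ z.1 i‖)}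

/-- The outcomes of the dropout procedure for which
`‖φ(x̂^i_i(t))‖_∞ ≤ (K / √h_i) ‖φ(x̂^i_i(t))‖` for all hidden layers `1 ≤ i ≤ d - 1`, all samples
and all `0 ≤ t ≤ 1`. -/
def spreadEvent (p : unitInterval) (θ : Params d h) (S : Finset (Vec (h 0) × Vec (h d)))
    (K : ℝ) : Set (Mask d h) :=
  {ω | ∀ i : ℕ, 1 ≤ i → i < d → ∀ z ∈ S, ∀ t ∈ Icc (0 : ℝ) 1, ∀ a : Fin (h i),
    |relu (noisyPreact p θ ω i t z.1 i) a|
      ≤ K / Real.sqrt (h i) * ‖relu (noisyPreact p θ ω i t z.1 i)‖}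

/-- `ε`-noise stability of the network `θ` on the sample `S`, for a loss with Lipschitz constant
`β`, for dropout probability `p`, and with `K` the constant in the bound on the sup norms of the
activations. Positivity of the cushions says that the quantities are meaningful: it forces all the
denominators in their definitions to be nonzero and the Jacobians to exist.
The interlayer smoothness is at least `3 d`. -/
structure IsNoiseStable (p : unitInterval) (K β : ℝ) (S : Finset (Vec (h 0) × Vec (h d)))
    (θ : Params d h) (ε : ℝ) : Prop where
  cushion_pos : 0 < minCushion θ S
  smooth : ∃ ρ : ℝ, 3 * (d : ℝ) ≤ ρ ∧
    1 / 2 ≤ dropoutLaw d h p (smoothEvent p θ S ρ ∩ spreadEvent p θ S K)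
  level_le : noiseLevel β θ S ≤ ε

end Network

/-- The logarithmic factor: the logarithm of (two plus) the sample size, the number of layers and
the sum of the widths `h 1, …, h d`. -/
def logFactor (d : ℕ) (h : ℕ → ℕ) (N : ℕ) : ℝ :=
  Real.log (2 + N + d + ∑ i ∈ Finset.Icc 1 d, h i)

/-- `π : [0,1] → V` is a continuous path from `a` to `b` consisting of `n` line segments
(parametrized so that the `m`-th segment is run through on `[m/n, (m+1)/n]`). -/
structure IsPolygonalPath {V : Type*} [AddCommGroup V] [Module ℝ V] [TopologicalSpace V]
    (n : ℕ) (π : ℝ → V) (a b : V) : Prop where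
  continuousOn : ContinuousOn π (Icc 0 1)
  source : π 0 = a
  target : π 1 = b
  segment : ∀ m : ℕ, m < n → ∀ s ∈ Icc (0 : ℝ) 1,
    π ((m + s) / n) = (1 - s) • π ((m : ℝ) / n) + s • π (((m : ℝ) + 1) / n)

end NoiseStability

end

/-!
If two networks with half-empty hidden layers use disjoint sets of hidden units, then each can be
written into the unused rows of the other without changing any output; the result differs from the
other network only in its last layer, where the output depends affinely on the parameter, so that
convexity bounds the loss along the connecting segment. Supports that meet are separated beforehand
by moving one of the networks to other units, through a network which carries it twice.

A noise stable network is joined to such a network by its dropout. A dropout rate of `3 / 4` leaves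
fewer than half of the units of every wide layer. Along the segment to the dropped out network, the
noise that one layer adds is a sum of independent centred terms whose coefficients are bounded
because activations are spread out; its tail is sub-Gaussian. Activations are polynomial in the
position on the segment between the sign changes of the units below, which makes a union bound over
polynomially many points possible. The cushions and the interlayer smoothness carry the noise of
each layer to the output at a bounded relative cost, and the costs of the layers add up.
-/

noncomputable section

namespace NoiseStability

variable {d : ℕ} {h : ℕ → ℕ}

/-! ### Polygonal paths -/

section Polygonal

variable {V : Type*} [AddCommGroup V] [Module ℝ V]

/-- `a` and `b` are the ends of a chain of `n` consecutive line segments inside `E`. -/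
def JoinedBySegments (E : Set V) (n : ℕ) (a b : V) : Prop :=
  ∃ P : ℕ → V, P 0 = a ∧ P n = b ∧ ∀ m < n, segment ℝ (P m) (P (m + 1)) ⊆ E

namespace JoinedBySegments

variable {E : Set V} {m n : ℕ} {a b c : V}

theorem refl (ha : a ∈ E) (n : ℕ) : JoinedBySegments E n a a :=
  ⟨fun _ => a, rfl, rfl, fun _ _ => by simpa [segment_same] using ha⟩

theorem of_segment_subset (hab : segment ℝ a b ⊆ E) : JoinedBySegments E 1 a b :=
  ⟨fun m => if m = 0 then a else b, by simp, by simp, fun m hm => by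
    obtain rfl : m = 0 := by omega
    simpa using hab⟩

theorem left_mem (hab : JoinedBySegments E n a b) (hn : 0 < n) : a ∈ E := by
  obtain ⟨P, rfl, -, hP⟩ := hab
  exact hP 0 hn (left_mem_segment ..)

theorem right_mem (hab : JoinedBySegments E n a b) (hn : 0 < n) : b ∈ E := by
  obtain ⟨n, rfl⟩ := Nat.exists_eq_add_of_le' hn
  obtain ⟨P, -, rfl, hP⟩ := hab
  exact hP n n.lt_succ_self (right_mem_segment ..)

theorem trans (hab : JoinedBySegments E m a b) (hbc : JoinedBySegments E n b c) :
    JoinedBySegments E (m + n) a c := by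
  obtain ⟨P, rfl, hPm, hP⟩ := hab
  obtain ⟨Q, hQ, rfl, hQE⟩ := hbc
  refine ⟨fun k => if k ≤ m then P k else Q (k - m), by simp, ?_, fun k hk => ?_⟩
  · rcases n.eq_zero_or_pos with rfl | hn
    · simp [hPm, hQ]
    · simp [hn.ne']
  · rcases lt_trichotomy k m with hkm | rfl | hkm
    · simpa only [if_pos hkm.le, if_pos (Nat.succ_le_of_lt hkm)] using hP k hkm
    · simpa [hPm, hQ] using hQE 0 (by omega)
    · simpa only [if_neg hkm.not_ge, if_neg (hkm.trans k.lt_succ_self).not_ge,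
        Nat.sub_add_comm hkm.le] using hQE (k - m) (by omega)

end JoinedBySegments

/-- The piecewise linear map sending every natural number `m ≤ n` to `P m`. -/
def piecewiseLinear (n : ℕ) (P : ℕ → V) (u : ℝ) : V :=
  P 0 + ∑ m ∈ Finset.range n, max 0 (min 1 (u - m)) • (P (m + 1) - P m)

theorem piecewiseLinear_add {n m : ℕ} (P : ℕ → V) (hm : m < n) {s : ℝ} (hs : s ∈ Icc (0 : ℝ) 1) :
    piecewiseLinear n P (m + s) = (1 - s) • P m + s • P (m + 1) := by
  have not_started : ∀ k ∈ Finset.range n, k ∉ Finset.range (m + 1) →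
      max 0 (min 1 (m + s - k)) • (P (k + 1) - P k) = 0 := fun k _ hk => by
    have hk : (m : ℝ) + 1 ≤ k := by exact_mod_cast not_lt.1 (mt Finset.mem_range.2 hk)
    rw [max_eq_left ((min_le_right _ _).trans (by linarith [hs.2])), zero_smul]
  have completed : ∀ k ∈ Finset.range m,
      max 0 (min 1 (m + s - k)) • (P (k + 1) - P k) = P (k + 1) - P k := fun k hk => by
    have hk : (k : ℝ) + 1 ≤ m := by exact_mod_cast Finset.mem_range.1 hk
    rw [min_eq_left (by linarith [hs.1]), max_eq_right zero_le_one, one_smul]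
  rw [piecewiseLinear, ← Finset.sum_subset (Finset.range_mono hm) not_started,
    Finset.sum_range_succ, Finset.sum_congr rfl completed, Finset.sum_range_sub,
    add_sub_cancel_left, min_eq_right hs.2, max_eq_right hs.1]
  module

theorem piecewiseLinear_natCast {n m : ℕ} (P : ℕ → V) (hm : m ≤ n) :
    piecewiseLinear n P m = P m := by
  rcases m with - | m
  · simp [piecewiseLinear]
  · simpa using piecewiseLinear_add P hm (s := 1) (by simp)

theorem exists_eq_natCast_add {n : ℕ} (hn : 0 < n) {u : ℝ} (hu : u ∈ Icc (0 : ℝ) n) :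
    ∃ m < n, ∃ s ∈ Icc (0 : ℝ) 1, u = m + s := by
  rcases hu.2.lt_or_eq with hun | rfl
  · exact ⟨⌊u⌋₊, (Nat.floor_lt hu.1).2 hun, u - ⌊u⌋₊,
      ⟨sub_nonneg.2 (Nat.floor_le hu.1), by linarith [Nat.lt_floor_add_one u]⟩, by ring⟩
  · exact ⟨n - 1, by omega, 1, by simp, by rw [Nat.cast_pred hn, sub_add_cancel]⟩

theorem JoinedBySegments.exists_isPolygonalPath [TopologicalSpace V] [ContinuousAdd V]
    [ContinuousSMul ℝ V] {E : Set V} {n : ℕ} (hn : 0 < n) {a b : V}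
    (hab : JoinedBySegments E n a b) :
    ∃ π : ℝ → V, IsPolygonalPath n π a b ∧ ∀ t ∈ Icc (0 : ℝ) 1, π t ∈ E := by
  obtain ⟨P, rfl, rfl, hP⟩ := hab
  have hn' : (0 : ℝ) < n := by exact_mod_cast hn
  refine ⟨fun t => piecewiseLinear n P (n * t), ⟨?_, ?_, ?_, fun m hm s hs => ?_⟩, fun t ht => ?_⟩
  · unfold piecewiseLinear
    fun_prop
  · simpa using piecewiseLinear_natCast P n.zero_le
  · simpa using piecewiseLinear_natCast P le_rfl
  · simp only [mul_div_cancel₀ _ hn'.ne', piecewiseLinear_add P hm hs,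
      piecewiseLinear_natCast P hm.le, ← Nat.cast_succ, piecewiseLinear_natCast P hm]
  · obtain ⟨m, hm, s, hs, hts⟩ := exists_eq_natCast_add hn (u := n * t)
      ⟨by have := ht.1; positivity, mul_le_of_le_one_right hn'.le ht.2⟩
    simp only [hts, piecewiseLinear_add P hm hs]
    exact hP m hm ⟨1 - s, s, sub_nonneg.2 hs.2, hs.1, sub_add_cancel _ _, rfl⟩

end Polygonal

/-! ### Evaluation of networks -/

theorem apply_coord {m n : ℕ} (A : Matrix (Fin m) (Fin n) ℝ) (v : Vec n) (a : Fin m) :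
    apply A v a = ∑ b, A a b * v b := by
  simp [apply, Matrix.mulVec, dotProduct]

@[simp] theorem relu_coord {n : ℕ} (v : Vec n) (a : Fin n) : relu v a = max (v a) 0 := rfl

theorem weight_of_lt (θ : Params d h) {n : ℕ} (hn : n < d) : weight θ n = θ ⟨n, hn⟩ :=
  dif_pos hn

theorem weight_smul_add_smul (θ θ' : Params d h) (s t : ℝ) (n : ℕ) :
    weight (s • θ + t • θ') n = s • weight θ n + t • weight θ' n := by
  unfold weight
  split_ifs <;> simp

theorem apply_smul_add_smul {m n : ℕ} (A B : Matrix (Fin m) (Fin n) ℝ) (s t : ℝ) (v : Vec n) :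
    apply (s • A + t • B) v = s • apply A v + t • apply B v := by
  ext a
  simp only [apply_coord, PiLp.add_apply, PiLp.smul_apply, Matrix.add_apply, Matrix.smul_apply,
    smul_eq_mul, Finset.mul_sum, ← Finset.sum_add_distrib]
  exact Finset.sum_congr rfl fun b _ => by ring

/-- The vector to which the matrix `A_{n+1}` is applied on input `x`: the input itself if `n = 0`,
the activations `φ(x^n)` otherwise. -/
def layerInput (θ : Params d h) (x : Vec (h 0)) : (n : ℕ) → Vec (h n)
  | 0 => x
  | n + 1 => relu (preact θ x (n + 1))

theorem preact_succ (θ : Params d h) (x : Vec (h 0)) (n : ℕ) :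
    preact θ x (n + 1) = apply (weight θ n) (layerInput θ x n) := by
  cases n <;> rfl

theorem layerInput_of_pos (θ : Params d h) (x : Vec (h 0)) {n : ℕ} (hn : 1 ≤ n) :
    layerInput θ x n = relu (preact θ x n) := by
  obtain ⟨n, rfl⟩ := Nat.exists_eq_add_of_le' hn
  rfl

theorem layerInput_congr {θ θ' : Params d h} (x : Vec (h 0)) {n : ℕ}
    (H : ∀ m < n, weight θ m = weight θ' m) : layerInput θ x n = layerInput θ' x n := by
  induction n with
  | zero => rfl
  | succ n ih =>
    rw [layerInput_of_pos _ _ n.succ_pos, layerInput_of_pos _ _ n.succ_pos, preact_succ,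
      preact_succ, H n n.lt_succ_self, ih fun m hm => H m (hm.trans n.lt_succ_self)]

theorem output_smul_add_smul_of_eq_below_last {θ θ' : Params d h}
    (H : ∀ n, n + 1 < d → weight θ n = weight θ' n) {s t : ℝ} (hst : s + t = 1) (x : Vec (h 0)) :
    output (s • θ + t • θ') x = s • output θ x + t • output θ' x := by
  rcases d with - | d
  · simp only [output, preact, ← add_smul, hst, one_smul]
  have below_last : ∀ n < d, weight (s • θ + t • θ') n = weight θ n := fun n hn => by
    rw [weight_smul_add_smul, ← H n (by omega), ← add_smul, hst, one_smul]
  unfold output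
  rw [preact_succ, preact_succ, preact_succ, layerInput_congr x below_last,
    layerInput_congr x (θ := θ') fun n hn => (H n (by omega)).symm, weight_smul_add_smul,
    apply_smul_add_smul]

/-! ### The loss -/

theorem convexOn_average {X Y E : Type*} [AddCommGroup E] [Module ℝ E] {l : Y → E → ℝ}
    (hl : ∀ y, ConvexOn ℝ univ (l y)) (S : Finset (X × Y)) :
    ConvexOn ℝ univ fun f : X → E => (S.card : ℝ)⁻¹ * ∑ z ∈ S, l z.2 (f z.1) := by
  refine ⟨convex_univ, fun f _ g _ s t hs ht hst => ?_⟩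
  calc (S.card : ℝ)⁻¹ * ∑ z ∈ S, l z.2 (s • f z.1 + t • g z.1)
      ≤ (S.card : ℝ)⁻¹ * ∑ z ∈ S, (s * l z.2 (f z.1) + t * l z.2 (g z.1)) := by
        gcongr with z
        exact (hl z.2).2 (mem_univ _) (mem_univ _) hs ht hst
    _ = _ := by
        rw [Finset.sum_add_distrib, ← Finset.mul_sum, ← Finset.mul_sum, smul_eq_mul, smul_eq_mul]
        ring

section Loss

variable {l : Vec (h d) → Vec (h d) → ℝ} {S : Finset (Vec (h 0) × Vec (h d))} {c : ℝ}

/-- The parameters at which the loss is at most `c`. -/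
def lossSublevel (l : Vec (h d) → Vec (h d) → ℝ) (S : Finset (Vec (h 0) × Vec (h d))) (c : ℝ) :
    Set (Params d h) :=
  {θ | loss l S θ ≤ c}

theorem lossSublevel_mono {c' : ℝ} (hc : c ≤ c') : lossSublevel l S c ⊆ lossSublevel l S c' :=
  fun _ hθ => le_trans hθ hc

theorem mem_lossSublevel_of_output_eq {θ θ' : Params d h} (H : ∀ x, output θ x = output θ' x)
    (hθ' : θ' ∈ lossSublevel l S c) : θ ∈ lossSublevel l S c := by
  simpa only [lossSublevel, loss, mem_ofPred_eq, H] using hθ'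

theorem segment_subset_lossSublevel_of_eq_below_last (hl : ∀ y, ConvexOn ℝ univ (l y))
    {θ θ' : Params d h} (H : ∀ n, n + 1 < d → weight θ n = weight θ' n)
    (hθ : θ ∈ lossSublevel l S c) (hθ' : θ' ∈ lossSublevel l S c) :
    segment ℝ θ θ' ⊆ lossSublevel l S c := by
  rintro _ ⟨s, t, hs, ht, hst, rfl⟩
  have houtput : output (s • θ + t • θ') = s • output θ + t • output θ' :=
    funext fun x => output_smul_add_smul_of_eq_below_last H hst x
  have := (convexOn_average hl S).convex_le c ⟨mem_univ (output θ), hθ⟩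
    ⟨mem_univ (output θ'), hθ'⟩ hs ht hst
  rw [← houtput] at this
  exact this.2

theorem loss_le_add_of_norm_output_sub_le (hS : S.Nonempty) {β D : ℝ} (hβ : 0 ≤ β)
    (hl : ∀ y u v, |l y u - l y v| ≤ β * ‖u - v‖) {θ θ' : Params d h}
    (H : ∀ z ∈ S, ‖output θ' z.1 - output θ z.1‖ ≤ D) :
    loss l S θ' ≤ loss l S θ + β * D := by
  have hc : (S.card : ℝ) ≠ 0 := by exact_mod_cast hS.card_pos.ne'
  calc loss l S θ' ≤ (S.card : ℝ)⁻¹ * ∑ z ∈ S, (l z.2 (output θ z.1) + β * D) := by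
        unfold loss
        gcongr with z hz
        have := (le_abs_self _).trans (hl z.2 (output θ' z.1) (output θ z.1))
        linarith [mul_le_mul_of_nonneg_left (H z hz) hβ]
    _ = loss l S θ + β * D := by
        rw [loss, Finset.sum_add_distrib, Finset.sum_const, nsmul_eq_mul, mul_add,
          inv_mul_cancel_left₀ hc]

end Loss

/-! ### Networks simulating each other -/

/-- On the units in `G`, every layer of `θ` computes what the layer of `θ'` computes on the images
under `r` of these units. -/
def Simulates (G : ∀ n, Set (Fin (h n))) (r : ∀ n, Fin (h n) → Fin (h n)) (θ θ' : Params d h) :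
    Prop :=
  ∀ n < d, ∀ a ∈ G (n + 1), ∀ v v' : Vec (h n), (∀ b ∈ G n, v b = v' (r n b)) →
    apply (weight θ n) v a = apply (weight θ' n) v' (r (n + 1) a)

namespace Simulates

variable {G : ∀ n, Set (Fin (h n))} {r : ∀ n, Fin (h n) → Fin (h n)} {θ θ₁ θ₂ θ' : Params d h}

theorem preact_eq (H : Simulates G r θ θ') (hr : ∀ a, r 0 a = a) (x : Vec (h 0)) {n : ℕ}
    (hn : n ≤ d) {a : Fin (h n)} (ha : a ∈ G n) : preact θ x n a = preact θ' x n (r n a) := by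
  induction n with
  | zero => rw [hr]; rfl
  | succ n ih =>
    rw [preact_succ, preact_succ]
    refine H n hn a ha _ _ fun b hb => ?_
    cases n with
    | zero => rw [hr]; rfl
    | succ n => simp only [layerInput, relu_coord, ih (by omega) hb]

theorem output_eq (H : Simulates G r θ θ') (hr₀ : ∀ a, r 0 a = a) (hrd : ∀ a, r d a = a)
    (hG : G d = univ) (x : Vec (h 0)) : output θ x = output θ' x := by
  ext a
  rw [output, H.preact_eq hr₀ x le_rfl (hG ▸ mem_univ a), hrd]
  rfl

theorem smul_add_smul (H₁ : Simulates G r θ₁ θ') (H₂ : Simulates G r θ₂ θ') {s t : ℝ}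
    (hst : s + t = 1) : Simulates G r (s • θ₁ + t • θ₂) θ' := fun n hn a ha v v' hv => by
  rw [weight_smul_add_smul, apply_smul_add_smul, PiLp.add_apply, PiLp.smul_apply, PiLp.smul_apply,
    H₁ n hn a ha v v' hv, H₂ n hn a ha v v' hv, ← add_smul, hst, one_smul]

theorem segment_subset_lossSublevel (H₁ : Simulates G r θ₁ θ') (H₂ : Simulates G r θ₂ θ')
    (hr₀ : ∀ a, r 0 a = a) (hrd : ∀ a, r d a = a) (hG : G d = univ)
    {l : Vec (h d) → Vec (h d) → ℝ} {S : Finset (Vec (h 0) × Vec (h d))} {c : ℝ}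
    (hθ' : θ' ∈ lossSublevel l S c) : segment ℝ θ₁ θ₂ ⊆ lossSublevel l S c := by
  rintro _ ⟨s, t, -, -, hst, rfl⟩
  exact mem_lossSublevel_of_output_eq ((H₁.smul_add_smul H₂ hst).output_eq hr₀ hrd hG) hθ'

end Simulates

/-- The units of `θ` in `U` do not read from units outside `U`. -/
def IsSupportedOn (θ : Params d h) (U : ∀ n, Set (Fin (h n))) : Prop :=
  ∀ n < d, ∀ a ∈ U (n + 1), ∀ b ∉ U n, weight θ n a b = 0

theorem IsSupportedOn.simulates_of_eqOn_rows {θ θ' : Params d h} {U : ∀ n, Set (Fin (h n))}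
    (hθ' : IsSupportedOn θ' U) (H : ∀ n < d, EqOn (weight θ n) (weight θ' n) (U (n + 1))) :
    Simulates U (fun _ => id) θ θ' := fun n hn a ha v v' hv => by
  rw [apply_coord, apply_coord]
  refine Finset.sum_congr rfl fun b _ => ?_
  rw [H n hn ha]
  by_cases hb : b ∈ U n
  · rw [hv b hb]
    rfl
  · simp only [id, hθ' n hn a ha b hb, zero_mul]

theorem IsSupportedOn.simulates_self {θ : Params d h} {U : ∀ n, Set (Fin (h n))}
    (hθ : IsSupportedOn θ U) : Simulates U (fun _ => id) θ θ :=
  hθ.simulates_of_eqOn_rows fun _ _ => eqOn_refl _ _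

/-! ### Connecting networks that use half of their units -/

theorem exists_perm_disjoint {α : Type*} [Fintype α] {A B : Set α}
    (hAB : A.ncard + B.ncard ≤ Fintype.card α) :
    ∃ σ : Equiv.Perm α, ∀ b ∈ B, σ b ∉ A ∧ (σ b ∈ B → σ b = b) := by
  classical
  lift A to Finset α using A.toFinite
  lift B to Finset α using B.toFinite
  simp only [ncard_coe_finset, Finset.mem_coe] at hAB ⊢
  have hcard : Fintype.card ↥(A ∩ B) ≤ Fintype.card ↥(A ∪ B)ᶜ := by
    have := Finset.card_union_add_card_inter A B
    rw [Fintype.card_coe, Fintype.card_coe, Finset.card_compl]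
    omega
  obtain ⟨e⟩ := Function.Embedding.nonempty_of_card_le hcard
  let f : α → α := fun b => if hb : b ∈ A ∩ B then e ⟨b, hb⟩ else b
  have hf_mem : ∀ b (hb : b ∈ A ∩ B), f b = e ⟨b, hb⟩ := fun b hb => dif_pos hb
  have hf_notMem : ∀ b, b ∉ A ∩ B → f b = b := fun b hb => dif_neg hb
  have he : ∀ b, (e b : α) ∉ A ∧ (e b : α) ∉ B := fun b => by simpa using (e b).2
  have hf : InjOn f B := by
    intro b hb b' hb' hbb'
    by_cases hA : b ∈ A ∩ B <;> by_cases hA' : b' ∈ A ∩ B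
    · rw [hf_mem b hA, hf_mem b' hA'] at hbb'
      exact congrArg Subtype.val (e.injective (Subtype.ext hbb'))
    · rw [hf_mem b hA, hf_notMem b' hA'] at hbb'
      exact absurd (hbb' ▸ hb') (he _).2
    · rw [hf_notMem b hA, hf_mem b' hA'] at hbb'
      exact absurd (hbb' ▸ hb) (he _).2
    · rwa [hf_notMem b hA, hf_notMem b' hA'] at hbb'
  obtain ⟨g, hg⟩ := Finset.exists_equiv_extend_of_card_eq (t := Finset.univ)
    Finset.card_univ.symm (Finset.subset_univ (B.image f)) hf
  refine ⟨g.trans (Equiv.subtypeUnivEquiv Finset.mem_univ), fun b hb => ?_⟩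
  change (g b : α) ∉ A ∧ ((g b : α) ∈ B → (g b : α) = b)
  rw [hg b hb]
  by_cases hbA : b ∈ A ∩ B
  · rw [hf_mem b hbA]
    exact ⟨(he _).1, fun h => absurd h (he _).2⟩
  · rw [hf_notMem b hbA]
    exact ⟨fun h => hbA (Finset.mem_inter.2 ⟨h, hb⟩), fun _ => rfl⟩

/-- `θ` computes its output from the units in `U`, which make up at most half of every hidden
layer. -/
structure IsHalfSupportedOn (θ : Params d h) (U : ∀ n, Set (Fin (h n))) : Prop where
  isSupportedOn : IsSupportedOn θ U
  last : U d = univ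
  ncard_le : ∀ n, 1 ≤ n → n < d → 2 * (U n).ncard ≤ h n

/-- `σ` moves the units in `U` to other places, and `r` finds the original of every unit of `U` and
of every moved unit. Neither does anything to the input and output layers. -/
structure IsRelocation (d : ℕ) (U : ∀ n, Set (Fin (h n))) (σ : ∀ n, Equiv.Perm (Fin (h n)))
    (r : ∀ n, Fin (h n) → Fin (h n)) : Prop where
  first : ∀ a, r 0 a = a
  last : ∀ a, r d a = a
  fix : ∀ n, ∀ b ∈ U n, r n b = b
  retract : ∀ n, ∀ b ∈ U n, r n (σ n b) = b

theorem exists_isRelocation_disjoint {U V : ∀ n, Set (Fin (h n))}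
    (hUV : ∀ n, 1 ≤ n → n < d → (U n).ncard + (V n).ncard ≤ h n) :
    ∃ σ r, IsRelocation d V σ r ∧ ∀ n, 1 ≤ n → n < d → ∀ b ∈ V n, σ n b ∉ U n := by
  classical
  have hlayer : ∀ n, ∃ (σ : Equiv.Perm (Fin (h n))) (r : Fin (h n) → Fin (h n)),
      (¬(1 ≤ n ∧ n < d) → ∀ a, r a = a) ∧ (∀ b ∈ V n, r b = b) ∧
      (∀ b ∈ V n, r (σ b) = b) ∧ (1 ≤ n → n < d → ∀ b ∈ V n, σ b ∉ U n) := by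
    intro n
    by_cases hn : 1 ≤ n ∧ n < d
    · obtain ⟨σ, hσ⟩ := exists_perm_disjoint (A := U n) (B := V n)
        (by simpa using hUV n hn.1 hn.2)
      refine ⟨σ, fun a => if a ∈ V n then a else σ.symm a, fun hn' => absurd hn hn',
        fun b hb => if_pos hb, fun b hb => ?_, fun _ _ b hb => (hσ b hb).1⟩
      by_cases hσb : σ b ∈ V n
      · simp only [(hσ b hb).2 hσb, if_pos hb]
      · simp only [if_neg hσb, Equiv.symm_apply_apply]
    · exact ⟨1, id, fun _ _ => rfl, fun _ _ => rfl, fun _ _ => rfl,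
        fun h1 h2 => absurd ⟨h1, h2⟩ hn⟩
  choose σ r hid hfix hretract hdisj using hlayer
  exact ⟨σ, r, ⟨hid 0 (by omega), hid d (by omega), hfix, hretract⟩, hdisj⟩

/-- The network in which unit `a` of every layer has the incoming weights of the unit `r a` of `θ`,
its connection to unit `b` being that to `s b`. -/
def reindex (r s : ∀ n, Fin (h n) → Fin (h n)) (θ : Params d h) : Params d h :=
  fun n => (θ n).submatrix (r _) (s _)

theorem weight_reindex (r s : ∀ n, Fin (h n) → Fin (h n)) (θ : Params d h) (n : ℕ) :
    weight (reindex r s θ) n = (weight θ n).submatrix (r (n + 1)) (s n) := by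
  unfold weight
  split_ifs <;> rfl

open Classical in
/-- The network whose units in `U` have the incoming weights they have in `θ`, and whose other units
have those of `θ'`. -/
def splice (U : ∀ n, Set (Fin (h n))) (θ θ' : Params d h) : Params d h :=
  fun n => (U (n + 1)).piecewise (θ n) (θ' n)

theorem eqOn_weight_splice (U : ∀ n, Set (Fin (h n))) (θ θ' : Params d h) (n : ℕ) :
    EqOn (weight (splice U θ θ') n) (weight θ n) (U (n + 1)) := by
  classical
  unfold weight
  split_ifs
  · exact piecewise_eqOn _ _ _
  · exact eqOn_refl _ _

theorem eqOn_weight_splice_compl (U : ∀ n, Set (Fin (h n))) (θ θ' : Params d h) (n : ℕ) :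
    EqOn (weight (splice U θ θ') n) (weight θ' n) (U (n + 1))ᶜ := by
  classical
  unfold weight
  split_ifs
  · exact piecewise_eqOn_compl _ _ _
  · exact eqOn_refl _ _

/-- The network with the last layer of `θ'` and all other layers of `θ`. -/
def replaceLast (θ θ' : Params d h) : Params d h :=
  fun n => if n.val + 1 = d then θ' n else θ n

theorem weight_replaceLast (θ θ' : Params d h) (n : ℕ) :
    weight (replaceLast θ θ') n = if n + 1 = d then weight θ' n else weight θ n := by
  unfold weight replaceLast
  split_ifs <;> rfl

theorem IsSupportedOn.simulates_reindex {θ : Params d h} {U : ∀ n, Set (Fin (h n))}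
    (hθ : IsSupportedOn θ U) {r : ∀ n, Fin (h n) → Fin (h n)} {e : ∀ n, Equiv.Perm (Fin (h n))}
    (he : ∀ n, ∀ b ∈ U n, r n (e n b) = b) :
    Simulates (fun n => r n ⁻¹' U n) r (reindex r (fun n => (e n).symm) θ) θ := by
  intro n hn a ha v v' hv
  rw [apply_coord, apply_coord, weight_reindex, ← Equiv.sum_comp (e n)]
  refine Finset.sum_congr rfl fun b _ => ?_
  rw [Matrix.submatrix_apply, Equiv.symm_apply_apply]
  by_cases hb : b ∈ U n
  · rw [hv (e n b) (by rwa [mem_preimage, he n b hb]), he n b hb]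
  · rw [hθ n hn _ ha b hb, zero_mul, zero_mul]

theorem IsRelocation.isSupportedOn_reindex {U : ∀ n, Set (Fin (h n))}
    {σ : ∀ n, Equiv.Perm (Fin (h n))} {r : ∀ n, Fin (h n) → Fin (h n)} {θ : Params d h}
    (hσ : IsRelocation d U σ r) (hθ : IsSupportedOn θ U) :
    IsSupportedOn (reindex r (fun n => (σ n).symm) θ) fun n => σ n '' U n := by
  rintro n hn _ ⟨a, ha, rfl⟩ b hb
  rw [weight_reindex, Matrix.submatrix_apply, hσ.retract _ a ha]
  exact hθ n hn a ha _ fun hσb => hb ⟨_, hσb, (σ n).apply_symm_apply b⟩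

section FiveSegments

variable {l : Vec (h d) → Vec (h d) → ℝ} {S : Finset (Vec (h 0) × Vec (h d))} {c : ℝ}
  {A B : Params d h}

theorem IsRelocation.joinedBySegments_reindex {U : ∀ n, Set (Fin (h n))}
    {σ : ∀ n, Equiv.Perm (Fin (h n))} {r : ∀ n, Fin (h n) → Fin (h n)}
    (hσ : IsRelocation d U σ r) (hB : IsSupportedOn B U) (hU : U d = univ)
    (hBc : B ∈ lossSublevel l S c) :
    JoinedBySegments (lossSublevel l S c) 2 (reindex r (fun n => (σ n).symm) B) B := by
  have relocated : Simulates _ r (reindex r (fun n => (σ n).symm) B) B :=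
    hB.simulates_reindex hσ.retract
  have copied : Simulates _ r (reindex r (fun _ => id) B) B :=
    hB.simulates_reindex (e := fun _ => 1) hσ.fix
  have copied_self : Simulates U (fun _ => id) (reindex r (fun _ => id) B) B :=
    hB.simulates_of_eqOn_rows fun n _ a ha => by
      rw [weight_reindex]
      exact congrArg (weight B n) (hσ.fix _ a ha)
  exact .trans
    (.of_segment_subset <| relocated.segment_subset_lossSublevel copied hσ.first hσ.last
      (by rw [hU, preimage_univ]) hBc)
    (.of_segment_subset <| copied_self.segment_subset_lossSublevel hB.simulates_self
      (fun _ => rfl) (fun _ => rfl) hU hBc)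

theorem joinedBySegments_of_isSupportedOn_disjoint (hl : ∀ y, ConvexOn ℝ univ (l y))
    {U V : ∀ n, Set (Fin (h n))} (hA : IsSupportedOn A U) (hB : IsSupportedOn B V)
    (hU : U d = univ) (hV : V d = univ) (hUV : ∀ n, 1 ≤ n → n < d → Disjoint (U n) (V n))
    (hAc : A ∈ lossSublevel l S c) (hBc : B ∈ lossSublevel l S c) :
    JoinedBySegments (lossSublevel l S c) 3 A B := by
  have splice_simulates : Simulates U (fun _ => id) (splice U A B) A :=
    hA.simulates_of_eqOn_rows fun n _ => eqOn_weight_splice U A B n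
  have replaced_simulates : Simulates V (fun _ => id) (replaceLast (splice U A B) B) B :=
    hB.simulates_of_eqOn_rows fun n hn a ha => by
      rw [weight_replaceLast]
      split_ifs
      · rfl
      · exact eqOn_weight_splice_compl U A B n
          ((hUV (n + 1) (by omega) (by omega)).notMem_of_mem_right ha)
  have toSplice := hA.simulates_self.segment_subset_lossSublevel splice_simulates
    (fun _ => rfl) (fun _ => rfl) hU hAc
  have fromReplaced := replaced_simulates.segment_subset_lossSublevel hB.simulates_self
    (fun _ => rfl) (fun _ => rfl) hV hBc
  exact .trans (.trans (.of_segment_subset toSplice)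
    (.of_segment_subset <| segment_subset_lossSublevel_of_eq_below_last hl
      (fun n hn => by rw [weight_replaceLast, if_neg hn.ne])
      (toSplice (right_mem_segment ..)) (fromReplaced (left_mem_segment ..))))
    (.of_segment_subset fromReplaced)

theorem IsHalfSupportedOn.joinedBySegments (hl : ∀ y, ConvexOn ℝ univ (l y))
    {U V : ∀ n, Set (Fin (h n))} (hA : IsHalfSupportedOn A U) (hB : IsHalfSupportedOn B V)
    (hAc : A ∈ lossSublevel l S c) (hBc : B ∈ lossSublevel l S c) :
    JoinedBySegments (lossSublevel l S c) 5 A B := by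
  obtain ⟨σ, r, hσ, hdisj⟩ := exists_isRelocation_disjoint (d := d) (U := U) (V := V)
    fun n h1 hn => by have := hA.ncard_le n h1 hn; have := hB.ncard_le n h1 hn; omega
  have hreindex := hσ.joinedBySegments_reindex hB.isSupportedOn hB.last hBc
  refine (joinedBySegments_of_isSupportedOn_disjoint hl hA.isSupportedOn
    (hσ.isSupportedOn_reindex hB.isSupportedOn) hA.last ?_ (fun n h1 hn => disjoint_right.2 ?_) hAc
    (hreindex.left_mem two_pos)).trans hreindex
  · rw [hB.last, image_univ, (σ d).surjective.range_eq]
  · rintro _ ⟨b, hb, rfl⟩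
    exact hdisj n h1 hn b hb

end FiveSegments

/-! ### Piecewise polynomial functions -/

/-- `s` and `t` lie in the same cell of the partition of the line into the points of `R` and the
open intervals between them. -/
def SameCell (R : Finset ℝ) (s t : ℝ) : Prop := ∀ r ∈ R, (r < s ↔ r < t) ∧ (r ≤ s ↔ r ≤ t)

namespace SameCell

variable {R R' : Finset ℝ} {s t u : ℝ}

theorem symm (H : SameCell R s t) : SameCell R t s :=
  fun r hr => ⟨(H r hr).1.symm, (H r hr).2.symm⟩

theorem trans (H₁ : SameCell R s t) (H₂ : SameCell R t u) : SameCell R s u :=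
  fun r hr => ⟨(H₁ r hr).1.trans (H₂ r hr).1, (H₁ r hr).2.trans (H₂ r hr).2⟩

theorem mono (hR : R ⊆ R') (H : SameCell R' s t) : SameCell R s t := fun r hr => H r (hR hr)

theorem eq_of_mem_uIcc (H : SameCell R s t) {r : ℝ} (hr : r ∈ R) (hrst : r ∈ uIcc s t) :
    s = t := by
  have := H r hr
  grind [mem_uIcc]

end SameCell

theorem sameCell_of_card_eq {R : Finset ℝ} {s t : ℝ}
    (H : (R.filter (· < s)).card + (R.filter (· ≤ s)).card =
      (R.filter (· < t)).card + (R.filter (· ≤ t)).card) : SameCell R s t := by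
  wlog hst : s ≤ t generalizing s t
  · exact (this H.symm (le_of_not_ge hst)).symm
  have hlt : R.filter (· < s) ⊆ R.filter (· < t) :=
    Finset.monotone_filter_right _ fun r _ hr => lt_of_lt_of_le hr hst
  have hle : R.filter (· ≤ s) ⊆ R.filter (· ≤ t) :=
    Finset.monotone_filter_right _ fun r _ hr => le_trans hr hst
  have hlt_card := Finset.card_le_card hlt
  have hle_card := Finset.card_le_card hle
  have hlt_eq := Finset.eq_of_subset_of_card_le hlt (by omega)
  have hle_eq := Finset.eq_of_subset_of_card_le hle (by omega)
  refine fun r hr => ⟨?_, ?_⟩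
  · simpa [hr] using Finset.ext_iff.1 hlt_eq r
  · simpa [hr] using Finset.ext_iff.1 hle_eq r

theorem exists_finset_sameCell (R : Finset ℝ) (I : Set ℝ) :
    ∃ T : Finset ℝ, T.card ≤ 2 * R.card + 1 ∧ ↑T ⊆ I ∧ ∀ t ∈ I, ∃ t' ∈ T, SameCell R t' t := by
  let j : ℝ → ℕ := fun t => (R.filter (· < t)).card + (R.filter (· ≤ t)).card
  have hj : ∀ t, j t ∈ Finset.range (2 * R.card + 1) := fun t => by
    have := Finset.card_filter_le R (· < t)
    have := Finset.card_filter_le R (· ≤ t)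
    simp only [Finset.mem_range, j]
    omega
  have hjI : j '' I ⊆ Finset.range (2 * R.card + 1) := image_subset_iff.2 fun t _ => hj t
  obtain ⟨T, hTI, hT⟩ := exists_subset_bijOn I j
  have hTfin : T.Finite :=
    Finite.of_finite_image (hT.image_eq ▸ (Finset.finite_toSet _).subset hjI) hT.injOn
  lift T to Finset ℝ using hTfin
  refine ⟨T, ?_, hTI, fun t ht => ?_⟩
  · rw [← ncard_coe_finset T, ← hT.injOn.ncard_image, hT.image_eq]
    exact (ncard_le_ncard hjI).trans (by rw [ncard_coe_finset, Finset.card_range])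
  · obtain ⟨t', ht', htt'⟩ := hT.surjOn (mem_image_of_mem j ht)
    exact ⟨t', ht', sameCell_of_card_eq htt'⟩

/-- On every cell of `R`, the function `f` is a polynomial of degree at most `n`. -/
def IsPiecewisePoly (R : Finset ℝ) (n : ℕ) (f : ℝ → ℝ) : Prop :=
  ∀ s, ∃ P : Polynomial ℝ, P.natDegree ≤ n ∧ ∀ t, SameCell R s t → f t = P.eval t

theorem isPiecewisePoly_const (R : Finset ℝ) (c : ℝ) : IsPiecewisePoly R 0 fun _ => c :=
  fun _ => ⟨Polynomial.C c, by simp, fun _ _ => by simp⟩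

namespace IsPiecewisePoly

variable {ι : Type*} [Fintype ι] {R R' : Finset ℝ} {n : ℕ}

theorem mono {f : ℝ → ℝ} (hf : IsPiecewisePoly R n f) (hR : R ⊆ R') : IsPiecewisePoly R' n f :=
  fun s => (hf s).imp fun _ hP => ⟨hP.1, fun t ht => hP.2 t (ht.mono hR)⟩

theorem sum_affine_mul {f : ι → ℝ → ℝ} (hf : ∀ i, IsPiecewisePoly R n (f i)) (p q : ι → ℝ) :
    IsPiecewisePoly R (n + 1) fun t => ∑ i, (t * p i + (1 - t) * q i) * f i t := by
  intro s
  choose P hPn hP using fun i => hf i s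
  refine ⟨∑ i, (Polynomial.C (p i - q i) * Polynomial.X + Polynomial.C (q i)) * P i, ?_, ?_⟩
  · refine Polynomial.natDegree_sum_le_of_forall_le _ _ fun i _ => ?_
    rw [add_comm n]
    exact Polynomial.natDegree_mul_le.trans (add_le_add Polynomial.natDegree_linear_le (hPn i))
  · intro t ht
    rw [Polynomial.eval_finsetSum]
    refine Finset.sum_congr rfl fun i _ => ?_
    rw [hP i t ht]
    simp only [Polynomial.eval_mul, Polynomial.eval_add, Polynomial.eval_C, Polynomial.eval_X]
    ring

theorem max_zero {f : ℝ → ℝ} (hf : IsPiecewisePoly R n f)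
    (hsign : ∀ s t, SameCell R s t → f s ≤ 0 → f t ≤ 0) :
    IsPiecewisePoly R n fun t => max (f t) 0 := by
  intro s
  by_cases hs : f s ≤ 0
  · exact ⟨0, by simp, fun t ht => by simp [hsign s t ht hs]⟩
  · obtain ⟨P, hPn, hP⟩ := hf s
    refine ⟨P, hPn, fun t ht => ?_⟩
    have hft : 0 < f t := not_le.1 (mt (hsign t s ht.symm) hs)
    rw [← hP t ht]
    exact max_eq_left hft.le

end IsPiecewisePoly

theorem exists_mem_roots_sub_C {P : Polynomial ℝ} {c s t : ℝ} (hs : P.eval s ≤ c)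
    (ht : c < P.eval t) : ∃ u ∈ uIcc s t, u ∈ (P - Polynomial.C c).roots := by
  obtain ⟨u, hu, huc⟩ := intermediate_value_uIcc P.continuous.continuousOn
    (mem_uIcc.2 (Or.inl ⟨hs, ht.le⟩))
  have hne : P - Polynomial.C c ≠ 0 := fun h0 => by
    rw [sub_eq_zero.1 h0, Polynomial.eval_C] at ht
    exact lt_irrefl c ht
  exact ⟨u, hu, by simpa [Polynomial.mem_roots hne, sub_eq_zero] using huc⟩

theorem exists_refinement_constant_levels {ι : Type*} [Fintype ι] {R : Finset ℝ} {n : ℕ}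
    {f : ι → ℝ → ℝ} (hf : ∀ i, IsPiecewisePoly R n (f i)) (Λ : Finset ℝ) :
    ∃ R' : Finset ℝ, R ⊆ R' ∧
      2 * R'.card + 1 ≤ (2 * R.card + 1) * (1 + 2 * (Fintype.card ι * (Λ.card * n))) ∧
      ∀ s t, SameCell R' s t → ∀ i, ∀ c ∈ Λ, f i s ≤ c → f i t ≤ c := by
  classical
  obtain ⟨T, hTc, -, hT⟩ := exists_finset_sameCell R univ
  choose P hPn hP using hf
  let Z : Finset ℝ := T.biUnion fun s => Finset.univ.biUnion fun i => Λ.biUnion fun c =>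
    (P i s - Polynomial.C c).roots.toFinset
  have hZ : Z.card ≤ (2 * R.card + 1) * (Fintype.card ι * (Λ.card * n)) := by
    refine (Finset.card_biUnion_le_card_mul _ _ _ fun s _ => ?_).trans
      (Nat.mul_le_mul_right _ hTc)
    refine Finset.card_biUnion_le_card_mul _ _ _ fun i _ => ?_
    refine Finset.card_biUnion_le_card_mul _ _ _ fun c _ => ?_
    refine (Multiset.toFinset_card_le _).trans ((Polynomial.card_roots' _).trans ?_)
    rw [Polynomial.natDegree_sub_C]
    exact hPn i s
  refine ⟨R ∪ Z, Finset.subset_union_left, ?_, fun s t hst i c hc hs => ?_⟩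
  · have := Finset.card_union_le R Z
    rw [mul_add, mul_one, mul_left_comm]
    omega
  · by_contra! ht
    obtain ⟨s₀, hs₀, hs₀s⟩ := hT s (mem_univ s)
    have hPs := hP i s₀ s hs₀s
    have hPt := hP i s₀ t (hs₀s.trans (hst.mono Finset.subset_union_left))
    obtain ⟨u, hu, hroot⟩ := exists_mem_roots_sub_C (hPs ▸ hs) (hPt ▸ ht)
    have huZ : u ∈ Z := Finset.mem_biUnion.2 ⟨s₀, hs₀, Finset.mem_biUnion.2 ⟨i, Finset.mem_univ i,
      Finset.mem_biUnion.2 ⟨c, hc, Multiset.mem_toFinset.2 hroot⟩⟩⟩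
    obtain rfl := hst.eq_of_mem_uIcc (Finset.mem_union_right R huZ) hu
    exact ht.not_ge hs

theorem max_zero_sub_max_zero_le_of_same_levels {B : ℝ} {M : ℕ} (hB : 0 < B) (hM : 0 < M)
    {u v : ℝ} (hu : max u 0 ≤ B) (hlevel : ∀ k ≤ M, u ≤ k * B / M → v ≤ k * B / M) :
    max v 0 - max u 0 ≤ B / M := by
  have hδ : 0 < B / M := by positivity
  set k := ⌈max u 0 / (B / M)⌉₊
  have hkM : k ≤ M := Nat.ceil_le.2 <| by
    rw [div_le_iff₀ hδ, mul_div_cancel₀ _ (by positivity)]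
    exact hu
  have hle : max u 0 ≤ k * B / M := by
    rw [mul_div_assoc, ← div_le_iff₀ hδ]
    exact Nat.le_ceil _
  have hlt : (k : ℝ) * B / M ≤ max u 0 + B / M := by
    rw [mul_div_assoc, ← le_div_iff₀ hδ, add_div, div_self hδ.ne']
    exact (Nat.ceil_lt_add_one (by positivity)).le
  have hv : v ≤ k * B / M := hlevel k hkM ((le_max_left _ _).trans hle)
  linarith [max_le hv (by positivity)]

theorem exists_net_max_zero {ι : Type*} [Fintype ι] {R : Finset ℝ} {n : ℕ} {f : ι → ℝ → ℝ}
    (hf : ∀ i, IsPiecewisePoly R n (f i)) (I : Set ℝ) {B : ℝ} {M : ℕ} (hB : 0 < B) (hM : 0 < M) :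
    ∃ T : Finset ℝ,
      T.card ≤ (2 * R.card + 1) * (1 + 2 * (Fintype.card ι * ((M + 1) * n))) ∧ ↑T ⊆ I ∧
      ((∀ t ∈ I, ∀ i, max (f i t) 0 ≤ B) →
        ∀ t ∈ I, ∃ t' ∈ T, ∀ i, |max (f i t) 0 - max (f i t') 0| ≤ B / M) := by
  let Λ : Finset ℝ := (Finset.range (M + 1)).image fun k : ℕ => (k : ℝ) * B / M
  have hΛ : Λ.card ≤ M + 1 := Finset.card_image_le.trans (Finset.card_range _).le
  have mem_Λ : ∀ k ≤ M, (k : ℝ) * B / M ∈ Λ := fun k hk =>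
    Finset.mem_image_of_mem _ (Finset.mem_range_succ_iff.2 hk)
  obtain ⟨R', -, hcard, hlevel⟩ := exists_refinement_constant_levels hf Λ
  obtain ⟨T, hTc, hTI, hT⟩ := exists_finset_sameCell R' I
  refine ⟨T, hTc.trans (hcard.trans (by gcongr)), hTI, fun hbound t ht => ?_⟩
  obtain ⟨t', ht', hcell⟩ := hT t ht
  refine ⟨t', ht', fun i => abs_sub_le_iff.2 ⟨?_, ?_⟩⟩
  · exact max_zero_sub_max_zero_le_of_same_levels hB hM (hbound t' (hTI ht') i)
      fun k hk => hlevel t' t hcell i _ (mem_Λ k hk)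
  · exact max_zero_sub_max_zero_le_of_same_levels hB hM (hbound t ht i)
      fun k hk => hlevel t t' hcell.symm i _ (mem_Λ k hk)

/-! ### Activations along a segment of networks -/

theorem isPiecewisePoly_preact_succ (θ θ' : Params d h) (x : Vec (h 0)) {n : ℕ} {R : Finset ℝ}
    (hR : ∀ b, IsPiecewisePoly R n fun t => layerInput (t • θ + (1 - t) • θ') x n b)
    (a : Fin (h (n + 1))) :
    IsPiecewisePoly R (n + 1) fun t => preact (t • θ + (1 - t) • θ') x (n + 1) a := by
  convert IsPiecewisePoly.sum_affine_mul hR (weight θ n a) (weight θ' n a) using 2 with t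
  rw [preact_succ, apply_coord, weight_smul_add_smul]
  simp

theorem exists_isPiecewisePoly_layerInput (θ θ' : Params d h) (x : Vec (h 0)) (n : ℕ) :
    ∃ R : Finset ℝ, 2 * R.card + 1 ≤ ∏ m ∈ Finset.Ico 1 (n + 1), (1 + 2 * (h m * m)) ∧
      ∀ b, IsPiecewisePoly R n fun t => layerInput (t • θ + (1 - t) • θ') x n b := by
  induction n with
  | zero => exact ⟨∅, by simp, fun b => isPiecewisePoly_const ∅ (x b)⟩
  | succ n ih =>
    obtain ⟨R, hRc, hR⟩ := ih
    have hpreact := isPiecewisePoly_preact_succ θ θ' x hR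
    obtain ⟨R', hRR', hcard, hsign⟩ := exists_refinement_constant_levels hpreact {0}
    refine ⟨R', ?_, fun b => ((hpreact b).mono hRR').max_zero fun s t hst =>
      hsign s t hst b 0 (Finset.mem_singleton_self 0)⟩
    rw [Finset.prod_Ico_succ_top (by omega)]
    simp only [Fintype.card_fin, Finset.card_singleton, one_mul] at hcard
    exact hcard.trans (Nat.mul_le_mul_right _ hRc)

/-- The number of points at which the activations of layer `n` along a segment of networks have to
be sampled. -/
def netSize (h : ℕ → ℕ) (n : ℕ) : ℕ :=
  (∏ m ∈ Finset.Ico 1 n, (1 + 2 * (h m * m))) * (1 + 2 * (h n * ((h n + 1) * n)))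

theorem exists_net_layerInput (θ θ' : Params d h) (x : Vec (h 0)) (I : Set ℝ) {n : ℕ} (hn : 1 ≤ n)
    {B : ℝ} (hB : 0 < B) (hh : 0 < h n) :
    ∃ T : Finset ℝ, T.card ≤ netSize h n ∧ ↑T ⊆ I ∧
      ((∀ t ∈ I, ∀ b, layerInput (t • θ + (1 - t) • θ') x n b ≤ B) →
        ∀ t ∈ I, ∃ t' ∈ T, ∀ b,
          |layerInput (t • θ + (1 - t) • θ') x n b - layerInput (t' • θ + (1 - t') • θ') x n b|
            ≤ B / h n) := by
  obtain ⟨n, rfl⟩ := Nat.exists_eq_add_of_le' hn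
  obtain ⟨R, hRc, hR⟩ := exists_isPiecewisePoly_layerInput θ θ' x n
  obtain ⟨T, hTc, hT⟩ := exists_net_max_zero (isPiecewisePoly_preact_succ θ θ' x hR) I hB hh
  rw [Fintype.card_fin] at hTc
  exact ⟨T, hTc.trans (Nat.mul_le_mul_right _ hRc), hT⟩

theorem netSize_le_pow {n N : ℕ} (hn : 1 ≤ n) (hN : ∀ m, 1 ≤ m → m ≤ n → 2 + m + h m ≤ N) :
    netSize h n ≤ N ^ (2 * n + 1) := by
  have hfactor : ∀ m ∈ Finset.Ico 1 n, 1 + 2 * (h m * m) ≤ N ^ 2 := fun m hm => by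
    have hm := Finset.mem_Ico.1 hm
    refine le_trans ?_ (Nat.pow_le_pow_left (hN m hm.1 hm.2.le) 2)
    nlinarith
  have hlast : 1 + 2 * (h n * ((h n + 1) * n)) ≤ N ^ 3 := by
    refine le_trans ?_ (Nat.pow_le_pow_left (hN n hn le_rfl) 3)
    ring_nf
    nlinarith
  calc netSize h n ≤ (N ^ 2) ^ (n - 1) * N ^ 3 :=
        Nat.mul_le_mul ((Finset.prod_le_pow_card _ _ _ hfactor).trans_eq (by rw [Nat.card_Ico]))
          hlast
    _ = N ^ (2 * n + 1) := by
        rw [← pow_mul, ← pow_add]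
        congr 1
        omega

/-! ### Concentration of the dropout noise -/

section UnionBound

variable {Ω ι : Type*} [MeasurableSpace Ω] {μ : Measure Ω}

theorem measureReal_biUnion_finset_le_card_mul (s : Finset ι) {F : ι → Set Ω} {δ : ℝ}
    (hF : ∀ i ∈ s, μ.real (F i) ≤ δ) : μ.real (⋃ i ∈ s, F i) ≤ s.card * δ :=
  (measureReal_biUnion_finset_le s F).trans <|
    (Finset.sum_le_card_nsmul s _ δ hF).trans_eq (nsmul_eq_mul _ _)

theorem exists_mem_forall_notMem_of_card_mul_lt [IsFiniteMeasure μ] (s : Finset ι)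
    {F : ι → Set Ω} {E : Set Ω} {δ : ℝ} (hF : ∀ i ∈ s, μ.real (F i) ≤ δ)
    (hE : s.card * δ < μ.real E) : ∃ ω ∈ E, ∀ i ∈ s, ω ∉ F i := by
  by_contra! hcover
  have hsub : E ⊆ ⋃ i ∈ s, F i := fun ω hω => by simpa using hcover ω hω
  exact hE.not_ge <| (measureReal_mono hsub (measure_ne_top _ _)).trans
    (measureReal_biUnion_finset_le_card_mul s hF)

theorem measureReal_pi_le_of_forall_update [Fintype ι] [DecidableEq ι] {X : ι → Type*}
    [∀ i, MeasurableSpace (X i)] (μ : ∀ i, Measure (X i)) [∀ i, IsProbabilityMeasure (μ i)]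
    {E : Set (∀ i, X i)} (hE : MeasurableSet E) (i : ι) {δ : ℝ} (hδ : 0 ≤ δ)
    (H : ∀ ω, (μ i).real {y | Function.update ω i y ∈ E} ≤ δ) : (Measure.pi μ).real E ≤ δ := by
  have key : ∫⁻ ω, E.indicator 1 ω ∂Measure.pi μ ≤ ∫⁻ _, ENNReal.ofReal δ ∂Measure.pi μ := by
    refine lintegral_le_of_lmarginal_le {i} (measurable_one.indicator hE) measurable_const
      fun ω => ?_
    have hslice : ∫⁻ y, E.indicator (1 : (∀ i, X i) → ENNReal) (Function.update ω i y) ∂μ i =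
        μ i {y | Function.update ω i y ∈ E} := by
      exact lintegral_indicator_one (measurable_update ω hE)
    rw [lmarginal_singleton, lmarginal_singleton]
    beta_reduce
    rw [hslice, lintegral_const, measure_univ, mul_one]
    exact (ENNReal.le_ofReal_iff_toReal_le (measure_ne_top _ _) hδ).2 (H ω)
  rw [lintegral_indicator_one hE, lintegral_const, measure_univ, mul_one] at key
  exact ENNReal.toReal_le_of_le_ofReal hδ key

end UnionBound

/-- The relative change of a column under dropout with probability `p`: the column is multiplied by
`1 + dropNoise p e`, where `e = true` means that it is dropped. -/
def dropNoise (p : unitInterval) (e : Bool) : ℝ :=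
  (if e = true then 0 else 1 / (1 - (p : ℝ))) - 1

/-- The law of the mask of a single layer with units `ι`. -/
abbrev maskLaw (p : unitInterval) (ι : Type*) [Fintype ι] : Measure (ι → Bool) :=
  Measure.pi fun _ => ProbabilityTheory.bernoulliMeasure true false p

section Concentration

open ProbabilityTheory

variable {p : unitInterval} {ι : Type*} [Fintype ι]

theorem dropNoise_mem_Icc (hp : (p : ℝ) < 1) (e : Bool) :
    dropNoise p e ∈ Icc (-1) ((1 - (p : ℝ))⁻¹ - 1) := by
  have : 0 ≤ (1 - (p : ℝ))⁻¹ := inv_nonneg.2 (sub_nonneg.2 hp.le)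
  cases e <;> simp [dropNoise, this]

theorem abs_dropNoise_le (hp : (p : ℝ) < 1) (e : Bool) : |dropNoise p e| ≤ (1 - (p : ℝ))⁻¹ := by
  have hinv : 1 ≤ (1 - (p : ℝ))⁻¹ := (one_le_inv₀ (sub_pos.2 hp)).2 (by linarith [p.2.1])
  have hmem := dropNoise_mem_Icc hp e
  exact abs_le.2 ⟨by linarith [hmem.1], by linarith [hmem.2]⟩

theorem integral_dropNoise (hp : (p : ℝ) < 1) :
    ∫ e, dropNoise p e ∂bernoulliMeasure true false p = 0 := by
  have : 1 - (p : ℝ) ≠ 0 := (sub_pos.2 hp).ne'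
  rw [integral_bernoulliMeasure]
  simp only [dropNoise]
  simp
  field_simp
  ring

theorem hasSubgaussianMGF_dropNoise (hp : (p : ℝ) < 1) :
    HasSubgaussianMGF (dropNoise p) ((‖(1 - (p : ℝ))⁻¹‖₊ / 2) ^ 2)
      (bernoulliMeasure true false p) := by
  have := hasSubgaussianMGF_of_mem_Icc_of_integral_eq_zero
    (measurable_of_countable (dropNoise p)).aemeasurable
    (ae_of_all _ (dropNoise_mem_Icc hp)) (integral_dropNoise hp)
  rwa [sub_neg_eq_add, sub_add_cancel] at this

theorem hasSubgaussianMGF_mul_dropNoise (hp : (p : ℝ) < 1) (c : ℝ) (b : ι) :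
    HasSubgaussianMGF (fun η : ι → Bool => c * dropNoise p (η b))
      (⟨c ^ 2, sq_nonneg c⟩ * (‖(1 - (p : ℝ))⁻¹‖₊ / 2) ^ 2) (maskLaw p ι) := by
  have hlaw : HasSubgaussianMGF (dropNoise p) ((‖(1 - (p : ℝ))⁻¹‖₊ / 2) ^ 2)
      ((maskLaw p ι).map fun η => η b) := by
    rw [(measurePreserving_eval (fun _ : ι => bernoulliMeasure true false p) b).map_eq]
    exact hasSubgaussianMGF_dropNoise hp
  exact (HasSubgaussianMGF.of_map (Y := fun η : ι → Bool => η b)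
    (measurable_pi_apply b).aemeasurable hlaw).const_mul c

theorem maskLaw_lt_sum_le (hp : (p : ℝ) < 1) (c : ι → ℝ) {σ lam : ℝ} (hσ : 0 ≤ σ)
    (hlam : 0 ≤ lam) (hc : ∑ b, c b ^ 2 ≤ σ ^ 2) :
    (maskLaw p ι).real {η | lam * σ < ∑ b, dropNoise p (η b) * c b} ≤
      Real.exp (-2 * ((1 - p) * lam) ^ 2) := by
  rcases (Finset.sum_nonneg fun b (_ : b ∈ Finset.univ) => sq_nonneg (c b)).eq_or_lt with h0 | h0
  · have hc0 : ∀ b, c b = 0 := fun b => by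
      simpa using (Finset.sum_eq_zero_iff_of_nonneg fun b _ => sq_nonneg (c b)).1 h0.symm b
        (Finset.mem_univ b)
    have : ¬ lam * σ < 0 := not_lt.2 (by positivity)
    simp [hc0, this, Real.exp_nonneg]
  have hq : 0 < 1 - (p : ℝ) := sub_pos.2 hp
  have hind : iIndepFun (fun b (η : ι → Bool) => c b * dropNoise p (η b)) (maskLaw p ι) :=
    iIndepFun_pi (X := fun b e => c b * dropNoise p e)
      fun b => (measurable_of_countable _).aemeasurable
  have htail := HasSubgaussianMGF.measure_sum_ge_le_of_iIndepFun hind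
    (s := Finset.univ) (fun b _ => hasSubgaussianMGF_mul_dropNoise hp (c b) b)
    (ε := lam * σ) (by positivity)
  have hvar : ((∑ b, (⟨c b ^ 2, sq_nonneg _⟩ * (‖(1 - (p : ℝ))⁻¹‖₊ / 2) ^ 2 : NNReal) :
      NNReal) : ℝ) = (∑ b, c b ^ 2) / (4 * (1 - p) ^ 2) := by
    rw [NNReal.coe_sum, Finset.sum_div]
    refine Finset.sum_congr rfl fun b _ => ?_
    change c b ^ 2 * (‖(1 - (p : ℝ))⁻¹‖ / 2) ^ 2 = _
    rw [Real.norm_of_nonneg (inv_nonneg.2 hq.le)]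
    field_simp
    norm_num
  refine (measureReal_mono fun η hη => ?_).trans (htail.trans (Real.exp_le_exp.2 ?_))
  · rw [mem_ofPred_eq] at hη ⊢
    exact hη.le.trans_eq (Finset.sum_congr rfl fun b _ => mul_comm _ _)
  · rw [hvar, div_le_iff₀ (by positivity)]
    field_simp
    nlinarith [mul_le_mul_of_nonneg_left hc (sq_nonneg lam)]

theorem maskLaw_lt_abs_sum_le (hp : (p : ℝ) < 1) (c : ι → ℝ) {σ lam : ℝ} (hσ : 0 ≤ σ)
    (hlam : 0 ≤ lam) (hc : ∑ b, c b ^ 2 ≤ σ ^ 2) :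
    (maskLaw p ι).real {η | lam * σ < |∑ b, dropNoise p (η b) * c b|} ≤
      2 * Real.exp (-2 * ((1 - p) * lam) ^ 2) := by
  have hupper := maskLaw_lt_sum_le hp c hσ hlam hc
  have hlower := maskLaw_lt_sum_le hp (fun b => -c b) hσ hlam (by simpa using hc)
  have hsub : {η : ι → Bool | lam * σ < |∑ b, dropNoise p (η b) * c b|} ⊆
      {η | lam * σ < ∑ b, dropNoise p (η b) * c b} ∪
        {η | lam * σ < ∑ b, dropNoise p (η b) * -c b} := fun η hη =>
    (lt_abs.1 (mem_ofPred_eq ▸ hη)).imp id fun hη => by simpa using hη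
  linarith [(measureReal_mono hsub).trans (measureReal_union_le (μ := maskLaw p ι) _ _)]

theorem maskLaw_lt_ncard_le (hp : (p : ℝ) < 1) :
    (maskLaw p ι).real {η | 2 * (1 - (p : ℝ)) * Fintype.card ι < {b | η b = false}.ncard} ≤
      Real.exp (-2 * (1 - p) ^ 2 * Fintype.card ι) := by
  have hq : 0 < 1 - (p : ℝ) := sub_pos.2 hp
  have hsum : ∀ η : ι → Bool, ∑ b, dropNoise p (η b) * 1 =
      {b | η b = false}.ncard / (1 - (p : ℝ)) - Fintype.card ι := fun η => by
    rw [ncard_eq_toFinset_card']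
    simp [dropNoise, Finset.sum_ite, div_eq_mul_inv]
  have hdev := maskLaw_lt_sum_le hp (fun _ : ι => 1) (Real.sqrt_nonneg (Fintype.card ι))
    (Real.sqrt_nonneg (Fintype.card ι)) (by simp)
  rw [mul_pow, Real.sq_sqrt (Nat.cast_nonneg _), ← mul_assoc] at hdev
  refine (measureReal_mono fun η hη => ?_).trans hdev
  rw [mem_ofPred_eq] at hη ⊢
  rw [hsum, Real.mul_self_sqrt (Nat.cast_nonneg _), lt_sub_iff_add_lt, lt_div_iff₀ hq]
  linarith

end Concentration

section NoisyImage

variable {p : unitInterval} {ι κ τ : Type*} [Fintype ι]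

/-- The norm of a row of a matrix. -/
def rowNorm (A : Matrix κ ι ℝ) (a : κ) : ℝ := Real.sqrt (∑ b, A a b ^ 2)

/-- The change of the vector `A v` when dropout with the mask `η` is applied to the columns of
`A`. -/
def maskNoise (p : unitInterval) (A : Matrix κ ι ℝ) (η : ι → Bool) (v : ι → ℝ) (a : κ) : ℝ :=
  ∑ b, dropNoise p (η b) * (A a b * v b)

theorem rowNorm_nonneg (A : Matrix κ ι ℝ) (a : κ) : 0 ≤ rowNorm A a := Real.sqrt_nonneg _

theorem sq_rowNorm (A : Matrix κ ι ℝ) (a : κ) : rowNorm A a ^ 2 = ∑ b, A a b ^ 2 :=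
  Real.sq_sqrt (Finset.sum_nonneg fun _ _ => sq_nonneg _)

theorem abs_le_rowNorm (A : Matrix κ ι ℝ) (a : κ) (b : ι) : |A a b| ≤ rowNorm A a :=
  Real.abs_le_sqrt <|
    Finset.single_le_sum (f := fun b => A a b ^ 2) (fun _ _ => sq_nonneg _) (Finset.mem_univ b)

theorem abs_maskNoise_le_add (hp : (p : ℝ) < 1) (A : Matrix κ ι ℝ) (η : ι → Bool)
    {v w : ι → ℝ} {B : ℝ} (hB : 0 ≤ B) (hvw : ∀ b, |v b - w b| ≤ B / Fintype.card ι) (a : κ) :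
    |maskNoise p A η v a| ≤ |maskNoise p A η w a| + (1 - (p : ℝ))⁻¹ * (rowNorm A a * B) := by
  have hr := rowNorm_nonneg A a
  have : 0 ≤ (1 - (p : ℝ))⁻¹ := inv_nonneg.2 (sub_nonneg.2 hp.le)
  have hsplit : maskNoise p A η v a = maskNoise p A η w a + maskNoise p A η (v - w) a := by
    simp only [maskNoise, ← Finset.sum_add_distrib, Pi.sub_apply]
    exact Finset.sum_congr rfl fun b _ => by ring
  have hterm : ∀ b ∈ Finset.univ, |dropNoise p (η b) * (A a b * (v - w) b)| ≤
      (1 - (p : ℝ))⁻¹ * (rowNorm A a * (B / Fintype.card ι)) := fun b _ => by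
    rw [abs_mul, abs_mul]
    gcongr
    exacts [abs_dropNoise_le hp _, abs_le_rowNorm A a b, hvw b]
  rw [hsplit]
  refine (abs_add_le _ _).trans (add_le_add_right ?_ _)
  calc |maskNoise p A η (v - w) a|
      ≤ Fintype.card ι * ((1 - (p : ℝ))⁻¹ * (rowNorm A a * (B / Fintype.card ι))) :=
        (Finset.abs_sum_le_sum_abs _ _).trans <|
          (Finset.sum_le_card_nsmul _ _ _ hterm).trans_eq (nsmul_eq_mul _ _)
    _ = (1 - (p : ℝ))⁻¹ * (rowNorm A a * (Fintype.card ι * (B / Fintype.card ι))) := by ring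
    _ ≤ (1 - (p : ℝ))⁻¹ * (rowNorm A a * B) := by
        gcongr
        rw [mul_div_left_comm]
        exact mul_le_of_le_one_right hB (div_self_le_one _)

theorem maskLaw_lt_abs_maskNoise_le (hp : (p : ℝ) < 1) (A : Matrix κ ι ℝ) {v : ι → ℝ}
    {B lam : ℝ} (hB : 0 ≤ B) (hlam : 0 ≤ lam) (hv : ∀ b, |v b| ≤ B) (a : κ) :
    (maskLaw p ι).real {η | lam * (rowNorm A a * B) < |maskNoise p A η v a|} ≤
      2 * Real.exp (-2 * ((1 - p) * lam) ^ 2) := by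
  refine maskLaw_lt_abs_sum_le hp _ (mul_nonneg (rowNorm_nonneg A a) hB) hlam ?_
  rw [mul_pow, sq_rowNorm, Finset.sum_mul]
  refine Finset.sum_le_sum fun b _ => ?_
  rw [mul_pow]
  exact mul_le_mul_of_nonneg_left (sq_le_sq' (abs_le.1 (hv b)).1 (abs_le.1 (hv b)).2) (sq_nonneg _)

theorem maskLaw_exists_lt_abs_maskNoise_le [Fintype κ] (hp : (p : ℝ) < 1) (A : Matrix κ ι ℝ)
    {v : τ → ι → ℝ} {I : Set τ} {T : Finset τ} {B lam : ℝ} (hB : 0 ≤ B) (hlam : 0 ≤ lam)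
    (hv : ∀ t ∈ T, ∀ b, |v t b| ≤ B)
    (hT : ∀ t ∈ I, ∃ t' ∈ T, ∀ b, |v t b - v t' b| ≤ B / Fintype.card ι) :
    (maskLaw p ι).real {η | ∃ t ∈ I, ∃ a,
        (lam + (1 - (p : ℝ))⁻¹) * (rowNorm A a * B) < |maskNoise p A η (v t) a|} ≤
      Fintype.card κ * (T.card * (2 * Real.exp (-2 * ((1 - p) * lam) ^ 2))) := by
  have hsub : {η | ∃ t ∈ I, ∃ a,
      (lam + (1 - (p : ℝ))⁻¹) * (rowNorm A a * B) < |maskNoise p A η (v t) a|} ⊆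
      ⋃ a ∈ (Finset.univ : Finset κ), ⋃ t ∈ T,
        {η | lam * (rowNorm A a * B) < |maskNoise p A η (v t) a|} := by
    rintro η ⟨t, ht, a, hlt⟩
    obtain ⟨t', ht', hclose⟩ := hT t ht
    simp only [mem_iUnion, mem_ofPred_eq]
    refine ⟨a, Finset.mem_univ a, t', ht', ?_⟩
    linarith [abs_maskNoise_le_add hp A η hB hclose a]
  refine (measureReal_mono hsub (measure_ne_top _ _)).trans ?_
  exact measureReal_biUnion_finset_le_card_mul _ fun a _ =>
    measureReal_biUnion_finset_le_card_mul T fun t ht =>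
      maskLaw_lt_abs_maskNoise_le hp A hB hlam (hv t ht) a

end NoisyImage

/-! ### Dropout of a layer -/

section Dropout

variable (p : unitInterval) (θ : Params d h) (ω : Mask d h)

/-- The units of layer `n` that survive the dropout: those whose column in `A_{n+1}` is kept. The
input and the output layer are not subject to dropout. -/
def aliveUnits (n : ℕ) : Set (Fin (h n)) := {b | ∀ hn : n < d, 1 ≤ n → ω ⟨n, hn⟩ b = false}

/-- The outcomes for which more than `2 (1 - p) h_n` units of layer `n` survive. -/
def crowdedEvent (d : ℕ) (h : ℕ → ℕ) (p : unitInterval) (n : ℕ) : Set (Mask d h) :=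
  {ω | 2 * (1 - (p : ℝ)) * h n < (aliveUnits ω n).ncard}

/-- The outcomes for which, on input `x`, the activations of layer `n` are at most `B` along the
segment from `θ^n` to `θ`, and yet dropout of this layer somewhere changes a unit `a` of the next
layer by more than `Λ B` times the norm of the row `a` of `A_{n+1}`. -/
def noisyEvent {n : ℕ} (hn : n < d) (x : Vec (h 0)) (B Λ : ℝ) : Set (Mask d h) :=
  {ω | (∀ t ∈ Icc (0 : ℝ) 1, ∀ b, relu (noisyPreact p θ ω n t x n) b ≤ B) ∧
    ∃ t ∈ Icc (0 : ℝ) 1, ∃ a, Λ * (rowNorm (weight θ n) a * B) <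
      |maskNoise p (weight θ n) (ω ⟨n, hn⟩) (relu (noisyPreact p θ ω n t x n)) a|}

theorem dropout_update (n : Fin d) (η : Fin (h n) → Bool) :
    dropout p θ (Function.update ω n η) n = dropout p θ ω n := by
  funext m
  ext a b
  simp only [dropout, Matrix.of_apply]
  by_cases hm : 1 ≤ m.val ∧ m.val + 1 ≤ n.val
  · have hmn : m ≠ n := fun e => by rw [e] at hm; omega
    simp only [if_pos hm, Function.update_of_ne hmn]
  · simp only [if_neg hm]

theorem noisyPreact_update {n : ℕ} (hn : n < d) (η : Fin (h n) → Bool) (t : ℝ) (x : Vec (h 0))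
    (i : ℕ) :
    noisyPreact p θ (Function.update ω ⟨n, hn⟩ η) n t x i = noisyPreact p θ ω n t x i := by
  rw [noisyPreact, dropout_update p θ ω ⟨n, hn⟩ η, noisyPreact]

end Dropout

instance (p : unitInterval) : IsProbabilityMeasure (dropoutLaw d h p) := by
  unfold dropoutLaw
  infer_instance

section LayerEvents

variable {p : unitInterval}

theorem dropoutLaw_crowdedEvent_le (hp : (p : ℝ) < 1) {n : ℕ} (hn : 1 ≤ n) (hnd : n < d) :
    (dropoutLaw d h p).real (crowdedEvent d h p n) ≤ Real.exp (-2 * (1 - p) ^ 2 * h n) := by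
  refine measureReal_pi_le_of_forall_update _ (Set.toFinite _).measurableSet ⟨n, hnd⟩
    (Real.exp_nonneg _) fun ω => ?_
  have := maskLaw_lt_ncard_le (ι := Fin (h n)) hp
  rw [Fintype.card_fin] at this
  simpa only [crowdedEvent, aliveUnits, mem_ofPred_eq, hn, hnd, forall_true_left,
    Function.update_self] using this

/-- The activations of layer `n` along the segment do not depend on the mask of that layer, so that
this mask may be drawn afresh. -/
theorem dropoutLaw_noisyEvent_le (hp : (p : ℝ) < 1) (θ : Params d h) (x : Vec (h 0)) {n : ℕ}
    (hn : 1 ≤ n) (hnd : n < d) (hh : 0 < h n) {B lam : ℝ} (hB : 0 < B) (hlam : 0 ≤ lam) :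
    (dropoutLaw d h p).real (noisyEvent p θ hnd x B (lam + (1 - (p : ℝ))⁻¹)) ≤
      h (n + 1) * (netSize h n * (2 * Real.exp (-2 * ((1 - p) * lam) ^ 2))) := by
  refine measureReal_pi_le_of_forall_update _ (Set.toFinite _).measurableSet ⟨n, hnd⟩
    (by positivity) fun ω => ?_
  simp only [noisyEvent, mem_ofPred_eq, noisyPreact_update, Function.update_self]
  by_cases hbound : ∀ t ∈ Icc (0 : ℝ) 1, ∀ b, relu (noisyPreact p θ ω n t x n) b ≤ B
  swap
  · simp only [hbound, false_and, ofPred_false, measureReal_empty]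
    positivity
  obtain ⟨T, hTcard, hTI, hT⟩ :=
    exists_net_layerInput θ (dropout p θ ω n) x (Icc 0 1) hn hB hh
  simp only [layerInput_of_pos _ _ hn] at hT
  have hnoise := maskLaw_exists_lt_abs_maskNoise_le (I := Icc 0 1) (T := T)
    (v := fun t b => relu (noisyPreact p θ ω n t x n) b) hp (weight θ n) hB.le hlam
    (fun t ht b => by
      rw [abs_of_nonneg (le_max_right _ _)]
      exact hbound t (hTI ht) b)
    (fun t ht => by simpa only [Fintype.card_fin] using! hT hbound t ht)
  refine (measureReal_mono (fun η hη => hη.2) (measure_ne_top _ _)).trans (hnoise.trans ?_)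
  rw [Fintype.card_fin]
  gcongr

theorem exists_mem_forall_notMem_of_half_le {E : Set (Mask d h)}
    (hE : 1 / 2 ≤ dropoutLaw d h p E) {F : Fin d → Set (Mask d h)} {δ : ℝ} (hδ₀ : 0 ≤ δ)
    (hδ : d * δ < 1 / 2) (hF : ∀ n : Fin d, 1 ≤ n.val → (dropoutLaw d h p).real (F n) ≤ δ) :
    ∃ ω ∈ E, ∀ n : Fin d, 1 ≤ n.val → ω ∉ F n := by
  have hhalf : (1 / 2 : ℝ) ≤ (dropoutLaw d h p).real E := by
    have := ENNReal.toReal_mono (measure_ne_top _ _) hE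
    simpa [Measure.real] using this
  have hcard : ((Finset.univ.filter fun n : Fin d => 1 ≤ n.val).card : ℝ) * δ ≤ d * δ := by
    gcongr
    exact_mod_cast (Finset.card_filter_le _ _).trans_eq (Finset.card_fin d)
  simpa using exists_mem_forall_notMem_of_card_mul_lt (E := E)
    (Finset.univ.filter fun n : Fin d => 1 ≤ n.val)
    (fun n hn => hF n (Finset.mem_filter.1 hn).2) (by linarith)

end LayerEvents

/-! ### Norms and homogeneity -/

theorem norm_relu_le {n : ℕ} (v : Vec n) : ‖relu v‖ ≤ ‖v‖ := by
  rw [EuclideanSpace.norm_eq, EuclideanSpace.norm_eq]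
  gcongr with a
  rw [relu_coord, Real.norm_eq_abs, Real.norm_eq_abs, abs_of_nonneg (le_max_right _ _)]
  exact max_le (le_abs_self _) (abs_nonneg _)

theorem frobeniusNorm_nonneg {m n : ℕ} (A : Matrix (Fin m) (Fin n) ℝ) : 0 ≤ frobeniusNorm A :=
  Real.sqrt_nonneg _

theorem norm_le_frobeniusNorm_mul {m n : ℕ} (A : Matrix (Fin m) (Fin n) ℝ) {D : ℝ} (hD : 0 ≤ D)
    {v : Vec m} (hv : ∀ a, |v a| ≤ rowNorm A a * D) : ‖v‖ ≤ frobeniusNorm A * D := by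
  have hsq : 0 ≤ ∑ a, ∑ b, A a b ^ 2 :=
    Finset.sum_nonneg fun _ _ => Finset.sum_nonneg fun _ _ => sq_nonneg _
  rw [EuclideanSpace.norm_eq, frobeniusNorm, ← Real.sqrt_sq hD, ← Real.sqrt_mul hsq,
    Finset.sum_mul]
  gcongr with a
  rw [← sq_rowNorm, ← mul_pow]
  exact pow_le_pow_left₀ (norm_nonneg _) (hv a) 2

theorem norm_apply_le {m n : ℕ} (A : Matrix (Fin m) (Fin n) ℝ) (v : Vec n) :
    ‖apply A v‖ ≤ frobeniusNorm A * ‖v‖ := by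
  refine norm_le_frobeniusNorm_mul A (norm_nonneg v) fun a => abs_le_of_sq_le_sq ?_
    (mul_nonneg (rowNorm_nonneg A a) (norm_nonneg v))
  rw [apply_coord, mul_pow, sq_rowNorm, EuclideanSpace.real_norm_sq_eq]
  exact Finset.sum_mul_sq_le_sq_mul_sq _ _ _

theorem apply_smul {m n : ℕ} (A : Matrix (Fin m) (Fin n) ℝ) (s : ℝ) (v : Vec n) :
    apply A (s • v) = s • apply A v := by
  ext a
  simp only [apply_coord, PiLp.smul_apply, smul_eq_mul, Finset.mul_sum]
  exact Finset.sum_congr rfl fun b _ => by ring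

theorem relu_smul {n : ℕ} {s : ℝ} (hs : 0 ≤ s) (v : Vec n) : relu (s • v) = s • relu v := by
  ext a
  simp only [relu_coord, PiLp.smul_apply, smul_eq_mul]
  rw [mul_max_of_nonneg _ _ hs, mul_zero]

theorem layers_succ (θ : Params d h) (i k : ℕ) (v : Vec (h i)) :
    layers θ i (k + 1) v = apply (weight θ (i + k)) (relu (layers θ i k v)) := rfl

theorem layers_smul (θ : Params d h) (i k : ℕ) {s : ℝ} (hs : 0 ≤ s) (v : Vec (h i)) :
    layers θ i k (s • v) = s • layers θ i k v := by
  induction k with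
  | zero => rfl
  | succ k ih => rw [layers_succ, layers_succ, ih, relu_smul hs, apply_smul]

theorem hasDerivAt_smul_one {E : Type*} [NormedAddCommGroup E] [NormedSpace ℝ E] (x : E) :
    HasDerivAt (fun s : ℝ => s • x) x 1 := by
  simpa using (hasDerivAt_id (1 : ℝ)).smul_const x

theorem fderiv_apply_self_of_homogeneous {E F : Type*} [NormedAddCommGroup E] [NormedSpace ℝ E]
    [NormedAddCommGroup F] [NormedSpace ℝ F] {f : E → F} {x : E}
    (hf : ∀ s : ℝ, 0 ≤ s → f (s • x) = s • f x) (hd : DifferentiableAt ℝ f x) :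
    fderiv ℝ f x x = f x := by
  have hcomp : HasDerivAt (fun s : ℝ => f (s • x)) (fderiv ℝ f x x) 1 := by
    have hx : HasFDerivAt f (fderiv ℝ f x) ((1 : ℝ) • x) := by
      rw [one_smul]
      exact hd.hasFDerivAt
    exact hx.comp_hasDerivAt 1 (hasDerivAt_smul_one x)
  have hlin : HasDerivAt (fun s : ℝ => f (s • x)) (f x) 1 := by
    refine (hasDerivAt_smul_one (f x)).congr_of_eventuallyEq ?_
    filter_upwards [lt_mem_nhds (zero_lt_one' ℝ)] with s hs
    exact hf s hs.le
  exact hcomp.unique hlin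

theorem preact_eq_layers {θ ψ : Params d h} {i : ℕ} (hi : 1 ≤ i)
    (H : ∀ n, i ≤ n → weight ψ n = weight θ n) (x : Vec (h 0)) (k : ℕ) :
    preact ψ x (i + k) = layers θ i k (preact ψ x i) := by
  induction k with
  | zero => rfl
  | succ k ih =>
    rw [layers_succ, ← ih, ← H _ (by omega), ← layerInput_of_pos _ _ (by omega)]
    exact preact_succ ψ x (i + k)

/-! ### Cushions -/

section Cushion

variable {θ : Params d h} {S : Finset (Vec (h 0) × Vec (h d))} {z : Vec (h 0) × Vec (h d)}

theorem layerCushion_nonneg (n : ℕ) : 0 ≤ layerCushion θ S n :=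
  Real.iInf_nonneg fun _ => div_nonneg (norm_nonneg _)
    (mul_nonneg (frobeniusNorm_nonneg _) (norm_nonneg _))

theorem minInterlayerCushion_nonneg (i : ℕ) : 0 ≤ minInterlayerCushion θ S i :=
  Real.iInf_nonneg fun _ => Real.iInf_nonneg fun _ => by positivity

theorem minCushion_nonneg : 0 ≤ minCushion θ S :=
  Real.iInf_nonneg fun _ => mul_nonneg (layerCushion_nonneg _) (minInterlayerCushion_nonneg _)

theorem activationContraction_nonneg : 0 ≤ activationContraction θ S :=
  Real.iSup_nonneg fun _ => by positivity

theorem minCushion_le {n : ℕ} (hn : 1 ≤ n) (hnd : n < d) :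
    minCushion θ S ≤ layerCushion θ S n * minInterlayerCushion θ S (n + 1) := by
  have := ciInf_le (Set.finite_range fun m : Fin (d - 1) =>
    layerCushion θ S (m.val + 1) * minInterlayerCushion θ S (m.val + 2)).bddBelow ⟨n - 1, by omega⟩
  obtain ⟨n, rfl⟩ := Nat.exists_eq_add_of_le' hn
  exact this

theorem layerCushion_pos (hc : 0 < minCushion θ S) {n : ℕ} (hn : 1 ≤ n) (hnd : n < d) :
    0 < layerCushion θ S n :=
  pos_of_mul_pos_left (hc.trans_le (minCushion_le hn hnd)) (minInterlayerCushion_nonneg _)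

theorem minInterlayerCushion_pos (hc : 0 < minCushion θ S) {n : ℕ} (hn : 1 ≤ n) (hnd : n < d) :
    0 < minInterlayerCushion θ S (n + 1) :=
  pos_of_mul_pos_right (hc.trans_le (minCushion_le hn hnd)) (layerCushion_nonneg _)

theorem layerCushion_le_div (hz : z ∈ S) {n : ℕ} (hn : 1 ≤ n) :
    layerCushion θ S n ≤ ‖preact θ z.1 (n + 1)‖ /
      (frobeniusNorm (weight θ n) * ‖relu (preact θ z.1 n)‖) := by
  rw [preact_succ, layerInput_of_pos _ _ hn]
  exact ciInf_le (Set.finite_range fun z : S => ‖apply (weight θ n) (relu (preact θ z.1.1 n))‖ /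
    (frobeniusNorm (weight θ n) * ‖relu (preact θ z.1.1 n)‖)).bddBelow ⟨z, hz⟩

theorem layerCushion_mul_le (hz : z ∈ S) {n : ℕ} (hn : 1 ≤ n) :
    layerCushion θ S n * (frobeniusNorm (weight θ n) * ‖relu (preact θ z.1 n)‖) ≤
      ‖preact θ z.1 (n + 1)‖ :=
  mul_le_of_le_div₀ (norm_nonneg _) (mul_nonneg (frobeniusNorm_nonneg _) (norm_nonneg _))
    (layerCushion_le_div hz hn)

theorem layerCushion_le_one (hS : S.Nonempty) {n : ℕ} (hn : 1 ≤ n) : layerCushion θ S n ≤ 1 := by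
  obtain ⟨z, hz⟩ := hS
  refine (layerCushion_le_div hz hn).trans (div_le_one_of_le₀ ?_
    (mul_nonneg (frobeniusNorm_nonneg _) (norm_nonneg _)))
  rw [preact_succ, layerInput_of_pos _ _ hn]
  exact norm_apply_le _ _

theorem minInterlayerCushion_le_div (hz : z ∈ S) {i k : ℕ} (hk : i + k ≤ d) :
    minInterlayerCushion θ S i ≤ ‖jacobian θ z.1 i k (preact θ z.1 i)‖ /
      (‖jacobian θ z.1 i k‖ * ‖preact θ z.1 i‖) := by
  refine (ciInf_le (Set.finite_range fun k : Fin (d - i + 1) =>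
    interlayerCushion θ S i k.val).bddBelow ⟨k, by omega⟩).trans ?_
  exact ciInf_le (Set.finite_range fun z : S => ‖jacobian θ z.1.1 i k (preact θ z.1.1 i)‖ /
    (‖jacobian θ z.1.1 i k‖ * ‖preact θ z.1.1 i‖)).bddBelow ⟨z, hz⟩

theorem minInterlayerCushion_le_one (hS : S.Nonempty) {i : ℕ} (hi : i ≤ d) :
    minInterlayerCushion θ S i ≤ 1 := by
  obtain ⟨z, hz⟩ := hS
  exact (minInterlayerCushion_le_div (k := 0) hz hi).trans (div_le_one_of_le₀
    (ContinuousLinearMap.le_opNorm _ _) (by positivity))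

theorem minCushion_le_one (hd : 2 ≤ d) (hS : S.Nonempty) : minCushion θ S ≤ 1 :=
  (minCushion_le le_rfl hd).trans (mul_le_one₀ (layerCushion_le_one hS le_rfl)
    (minInterlayerCushion_nonneg _) (minInterlayerCushion_le_one hS hd))

/-- Positive homogeneity of the layers turns the numerator `‖J x‖` of the interlayer cushion into
the norm of a preactivation. -/
theorem minInterlayerCushion_mul_le (hz : z ∈ S) {i k : ℕ} (hi : 1 ≤ i) (hk : i + k ≤ d) :
    minInterlayerCushion θ S i * (‖jacobian θ z.1 i k‖ * ‖preact θ z.1 i‖) ≤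
      ‖preact θ z.1 (i + k)‖ := by
  by_cases hdiff : DifferentiableAt ℝ (layers θ i k) (preact θ z.1 i)
  · have heuler : jacobian θ z.1 i k (preact θ z.1 i) = preact θ z.1 (i + k) := by
      rw [preact_eq_layers hi (fun _ _ => rfl)]
      exact fderiv_apply_self_of_homogeneous (fun s hs => layers_smul θ i k hs _) hdiff
    rw [← heuler]
    exact mul_le_of_le_div₀ (norm_nonneg _) (by positivity) (minInterlayerCushion_le_div hz hk)
  · rw [jacobian, fderiv_zero_of_not_differentiableAt hdiff, norm_zero, zero_mul, mul_zero]
    exact norm_nonneg _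

theorem norm_relu_preact_pos (hc : 0 < minCushion θ S) (hz : z ∈ S) {n : ℕ} (hn : 1 ≤ n)
    (hnd : n < d) : 0 < ‖relu (preact θ z.1 n)‖ := by
  have hratio := (layerCushion_pos hc hn hnd).trans_le (layerCushion_le_div hz hn)
  exact (norm_nonneg _).lt_of_ne' (right_ne_zero_of_mul (div_ne_zero_iff.1 hratio.ne').2)

theorem norm_preact_pos (hc : 0 < minCushion θ S) (hd : 2 ≤ d) (hz : z ∈ S) {n : ℕ}
    (hn : 1 ≤ n) (hnd : n ≤ d) : 0 < ‖preact θ z.1 n‖ := by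
  rcases hnd.lt_or_eq with hnd | rfl
  · exact (norm_relu_preact_pos hc hz hn hnd).trans_le (norm_relu_le _)
  · obtain ⟨n, rfl⟩ := Nat.exists_eq_add_of_le' hn
    have hratio := (layerCushion_pos hc (n := n) (by omega) (by omega)).trans_le
      (layerCushion_le_div hz (by omega))
    exact (norm_nonneg _).lt_of_ne' (div_ne_zero_iff.1 hratio.ne').1

theorem norm_preact_le_activationContraction_mul (hc : 0 < minCushion θ S) (hz : z ∈ S) {n : ℕ}
    (hn : 1 ≤ n) (hnd : n < d) :
    ‖preact θ z.1 n‖ ≤ activationContraction θ S * ‖relu (preact θ z.1 n)‖ := by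
  rw [← div_le_iff₀ (norm_relu_preact_pos hc hz hn hnd)]
  have := le_ciSup (Set.finite_range fun q : S × Fin (d - 1) =>
    ‖preact θ q.1.1.1 (q.2.val + 1)‖ / ‖relu (preact θ q.1.1.1 (q.2.val + 1))‖).bddAbove
    (⟨z, hz⟩, ⟨n - 1, by omega⟩)
  obtain ⟨n, rfl⟩ := Nat.exists_eq_add_of_le' hn
  exact this

theorem one_le_activationContraction (hc : 0 < minCushion θ S) (hd : 2 ≤ d) (hS : S.Nonempty) :
    1 ≤ activationContraction θ S := by
  obtain ⟨z, hz⟩ := hS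
  refine le_of_mul_le_mul_right ?_ (norm_relu_preact_pos hc hz le_rfl (by omega))
  rw [one_mul]
  exact (norm_relu_le _).trans (norm_preact_le_activationContraction_mul hc hz le_rfl (by omega))

theorem minWidth_le {n : ℕ} (hn : 1 ≤ n) (hnd : n < d) : minWidth d h ≤ h n := by
  have := ciInf_le (Set.finite_range fun m : Fin (d - 1) => h (m.val + 1)).bddBelow
    ⟨n - 1, by omega⟩
  obtain ⟨n, rfl⟩ := Nat.exists_eq_add_of_le' hn
  exact this

theorem width_pos (hc : 0 < minCushion θ S) (hS : S.Nonempty) {n : ℕ} (hn : 1 ≤ n)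
    (hnd : n < d) : 0 < h n := by
  obtain ⟨z, hz⟩ := hS
  by_contra hzero
  have : IsEmpty (Fin (h n)) := by
    rw [Nat.eq_zero_of_not_pos hzero]
    infer_instance
  exact (norm_pos_iff.1 (norm_relu_preact_pos hc hz hn hnd)) (Subsingleton.elim _ _)

theorem minWidth_pos (hc : 0 < minCushion θ S) (hd : 2 ≤ d) (hS : S.Nonempty) :
    0 < minWidth d h := by
  have : Nonempty (Fin (d - 1)) := ⟨⟨0, by omega⟩⟩
  obtain ⟨n, hn⟩ := exists_eq_ciInf_of_finite (f := fun n : Fin (d - 1) => h (n.val + 1))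
  rw [minWidth, ← hn]
  exact width_pos hc hS (by omega) (by omega)

end Cushion

/-! ### Propagation of the dropout noise -/

section NoisyPreact

variable (p : unitInterval) (θ : Params d h) (ω : Mask d h) (t : ℝ)

theorem weight_dropout_of_le {m n : ℕ} (hn : n = 0 ∨ m ≤ n) :
    weight (t • θ + (1 - t) • dropout p θ ω m) n = weight θ n := by
  have hdropout : weight (dropout p θ ω m) n = weight θ n := by
    unfold weight
    split_ifs with hnd
    · ext a b
      have hkept : ¬ (1 ≤ n ∧ n + 1 ≤ m) := by omega
      simp only [dropout, Matrix.of_apply, if_neg hkept]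
    · rfl
  rw [weight_smul_add_smul, hdropout, ← add_smul, add_sub_cancel, one_smul]

theorem weight_dropout_of_lt {m n : ℕ} (hnd : n < d) (hn : 1 ≤ n) (hm : n < m)
    (a : Fin (h (n + 1))) (b : Fin (h n)) :
    weight (t • θ + (1 - t) • dropout p θ ω m) n a b =
      weight θ n a b + (1 - t) * (dropNoise p (ω ⟨n, hnd⟩ b) * weight θ n a b) := by
  have hdropped : 1 ≤ n ∧ n + 1 ≤ m := ⟨hn, hm⟩
  rw [weight_smul_add_smul, Matrix.add_apply, Matrix.smul_apply, Matrix.smul_apply,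
    weight_of_lt _ hnd, weight_of_lt _ hnd]
  simp only [dropout, Matrix.of_apply, if_pos hdropped, dropNoise, smul_eq_mul]
  ring

variable (x : Vec (h 0))

theorem noisyPreact_one (j : ℕ) : noisyPreact p θ ω 1 t x j = preact θ x j := by
  have hweight : t • θ + (1 - t) • dropout p θ ω 1 = θ := by
    funext n
    have := weight_dropout_of_le p θ ω t (m := 1) (n := n) (by omega)
    rwa [weight_of_lt _ n.2, weight_of_lt _ n.2] at this
  rw [noisyPreact, hweight]

theorem noisyPreact_eq_layers {m i : ℕ} (hi : 1 ≤ i) (hm : m ≤ i) (k : ℕ) :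
    noisyPreact p θ ω m t x (i + k) = layers θ i k (noisyPreact p θ ω m t x i) :=
  preact_eq_layers hi (fun _ hn => weight_dropout_of_le p θ ω t (Or.inr (hm.trans hn))) x k

theorem layerInput_dropout_succ {n : ℕ} (hn : 1 ≤ n) (hnd : n < d) :
    layerInput (t • θ + (1 - t) • dropout p θ ω (n + 1)) x n =
      relu (noisyPreact p θ ω n t x n) := by
  rw [noisyPreact, ← layerInput_of_pos _ _ hn]
  refine layerInput_congr x fun m hm => ?_
  rcases Nat.eq_zero_or_pos m with rfl | hm₀
  · rw [weight_dropout_of_le _ _ _ _ (Or.inl rfl), weight_dropout_of_le _ _ _ _ (Or.inl rfl)]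
  · ext a b
    rw [weight_dropout_of_lt _ _ _ _ (by omega) hm₀ (by omega),
      weight_dropout_of_lt _ _ _ _ (by omega) hm₀ hm]

theorem noisyPreact_succ_sub_coord {n : ℕ} (hn : 1 ≤ n) (hnd : n < d) (a : Fin (h (n + 1))) :
    (noisyPreact p θ ω (n + 1) t x (n + 1) - noisyPreact p θ ω n t x (n + 1)) a =
      (1 - t) * maskNoise p (weight θ n) (ω ⟨n, hnd⟩) (relu (noisyPreact p θ ω n t x n)) a := by
  have hsucc : noisyPreact p θ ω (n + 1) t x (n + 1) =
      apply (weight (t • θ + (1 - t) • dropout p θ ω (n + 1)) n)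
        (relu (noisyPreact p θ ω n t x n)) := by
    rw [noisyPreact, preact_succ, layerInput_dropout_succ p θ ω t x hn hnd]
  have hself : noisyPreact p θ ω n t x (n + 1) =
      apply (weight θ n) (relu (noisyPreact p θ ω n t x n)) := by
    rw [noisyPreact, preact_succ, weight_dropout_of_le _ _ _ _ (Or.inr le_rfl),
      layerInput_of_pos _ _ hn, noisyPreact]
  rw [PiLp.sub_apply, hsucc, hself, apply_coord, apply_coord, ← Finset.sum_sub_distrib, maskNoise,
    Finset.mul_sum]
  refine Finset.sum_congr rfl fun b _ => ?_
  rw [weight_dropout_of_lt _ _ _ _ hnd hn n.lt_succ_self]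
  ring

end NoisyPreact

/-- Twice the bound on the activations of layer `n` that `spreadEvent` would give if there were no
noise. It leaves room for a noise as large as the preactivations themselves. -/
def actBound (K : ℝ) (θ : Params d h) (n : ℕ) (x : Vec (h 0)) : ℝ :=
  K / Real.sqrt (h n) * (2 * ‖preact θ x n‖)

/-- The size of the noise that dropout of one layer causes in the next layer, relative to the
minimal interlayer cushion and the preactivations there, if the deviation of each unit is at most
`Λ` times its scale. -/
def relNoise (K Λ : ℝ) (θ : Params d h) (S : Finset (Vec (h 0) × Vec (h d))) : ℝ :=
  2 * Λ * K * activationContraction θ S / (Real.sqrt (minWidth d h) * minCushion θ S)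

theorem norm_map_sub_map_le_of_linear {E F : Type*} [NormedAddCommGroup E] [NormedSpace ℝ E]
    [NormedAddCommGroup F] [NormedSpace ℝ F] (f : E → F) (J : E →L[ℝ] F) (u w : E) :
    ‖f u - f w‖ ≤ ‖f u - J u‖ + ‖f w - J w‖ + ‖J‖ * ‖u - w‖ := by
  have hsplit : f u - f w = (f u - J u) - (f w - J w) + J (u - w) := by
    rw [map_sub]
    abel
  rw [hsplit]
  exact (norm_add_le _ _).trans (add_le_add (norm_sub_le _ _) (J.le_opNorm _))

section Propagation

variable {p : unitInterval} {θ : Params d h} {S : Finset (Vec (h 0) × Vec (h d))}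
  {K Λ ρ γ δ t : ℝ} {ω : Mask d h} {z : Vec (h 0) × Vec (h d)}

theorem relNoise_nonneg (hK : 0 ≤ K) (hΛ : 0 ≤ Λ) : 0 ≤ relNoise K Λ θ S :=
  div_nonneg (mul_nonneg (by positivity) activationContraction_nonneg)
    (mul_nonneg (Real.sqrt_nonneg _) minCushion_nonneg)

theorem frobeniusNorm_mul_actBound_le (hc : 0 < minCushion θ S) (hK : 0 ≤ K) (hΛ : 0 ≤ Λ)
    (hz : z ∈ S) {n : ℕ} (hn : 1 ≤ n) (hnd : n < d) :
    frobeniusNorm (weight θ n) * (Λ * actBound K θ n z.1) ≤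
      relNoise K Λ θ S * minInterlayerCushion θ S (n + 1) * ‖preact θ z.1 (n + 1)‖ := by
  have hwidth : 0 < Real.sqrt (minWidth d h) :=
    Real.sqrt_pos.2 (by exact_mod_cast minWidth_pos hc (by omega) ⟨z, hz⟩)
  have hsqrt : Real.sqrt (minWidth d h) ≤ Real.sqrt (h n) :=
    Real.sqrt_le_sqrt (by exact_mod_cast minWidth_le hn hnd)
  have hcushion := layerCushion_mul_le (θ := θ) hz hn
  have hcontraction := norm_preact_le_activationContraction_mul hc hz hn hnd
  have hmin := minCushion_le (θ := θ) (S := S) hn hnd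
  unfold actBound relNoise
  set A := frobeniusNorm (weight θ n)
  set c := activationContraction θ S
  set R := ‖relu (preact θ z.1 n)‖
  set w := Real.sqrt (minWidth d h)
  set μ := layerCushion θ S n
  set ν := minInterlayerCushion θ S (n + 1)
  have hA : 0 ≤ A := frobeniusNorm_nonneg _
  have hc₀ : 0 ≤ c := activationContraction_nonneg
  have hμ : 0 < μ := layerCushion_pos hc hn hnd
  have hν : 0 < ν := minInterlayerCushion_pos hc hn hnd
  calc A * (Λ * (K / Real.sqrt (h n) * (2 * ‖preact θ z.1 n‖)))
      ≤ A * (Λ * (K / w * (2 * (c * R)))) := by gcongr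
    _ = 2 * Λ * K * c / (w * (μ * ν)) * ν * (μ * (A * R)) := by field_simp
    _ ≤ 2 * Λ * K * c / (w * minCushion θ S) * ν * ‖preact θ z.1 (n + 1)‖ := by gcongr

/-- If dropout of the layers below `n` at most doubles the preactivations of layer `n`, then the
activations there are spread out enough for the concentration of the noise of layer `n`. -/
theorem norm_noisyPreact_succ_sub_le_of_notMem (hc : 0 < minCushion θ S) (hK : 0 ≤ K)
    (hΛ : 0 ≤ Λ) (hspread : ω ∈ spreadEvent p θ S K) (hz : z ∈ S) {n : ℕ} (hn : 1 ≤ n)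
    (hnd : n < d) (hquiet : ω ∉ noisyEvent p θ hnd z.1 (actBound K θ n z.1) Λ)
    (hclose : ∀ t ∈ Icc (0 : ℝ) 1,
      ‖noisyPreact p θ ω n t z.1 n - preact θ z.1 n‖ ≤ ‖preact θ z.1 n‖)
    (ht : t ∈ Icc (0 : ℝ) 1) :
    ‖noisyPreact p θ ω (n + 1) t z.1 (n + 1) - noisyPreact p θ ω n t z.1 (n + 1)‖ ≤
      relNoise K Λ θ S * minInterlayerCushion θ S (n + 1) * ‖preact θ z.1 (n + 1)‖ := by
  have hact : ∀ t ∈ Icc (0 : ℝ) 1, ∀ b,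
      relu (noisyPreact p θ ω n t z.1 n) b ≤ actBound K θ n z.1 := fun t ht b => by
    refine (le_abs_self _).trans ((hspread n hn hnd z hz t ht b).trans ?_)
    unfold actBound
    gcongr
    linarith [norm_relu_le (noisyPreact p θ ω n t z.1 n), hclose t ht,
      norm_le_norm_add_norm_sub' (noisyPreact p θ ω n t z.1 n) (preact θ z.1 n)]
  have hB : 0 ≤ actBound K θ n z.1 := by
    unfold actBound
    positivity
  refine le_trans (norm_le_frobeniusNorm_mul _ (mul_nonneg hΛ hB) fun a => ?_)
    (frobeniusNorm_mul_actBound_le hc hK hΛ hz hn hnd)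
  have hnoise : |maskNoise p (weight θ n) (ω ⟨n, hnd⟩) (relu (noisyPreact p θ ω n t z.1 n)) a| ≤
      Λ * (rowNorm (weight θ n) a * actBound K θ n z.1) :=
    not_lt.1 fun hlt => hquiet ⟨hact, t, ht, a, hlt⟩
  rw [noisyPreact_succ_sub_coord p θ ω t z.1 hn hnd, abs_mul, mul_left_comm]
  exact (mul_le_of_le_one_left (abs_nonneg _)
    (abs_le.2 ⟨by linarith [ht.2], by linarith [ht.1]⟩)).trans hnoise

theorem smoothnessBound_le (hρ : 3 * (d : ℝ) ≤ ρ) (hd : 0 < d) (hδ : 0 ≤ δ) {r X Y : ℝ}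
    (hX : 0 ≤ X) (hY : 0 ≤ Y) (hr : r ≤ δ * X) : r * Y / (ρ * X) ≤ δ / (3 * d) * Y := by
  have hd' : (0 : ℝ) < d := by exact_mod_cast hd
  have hρ₀ : 0 < ρ := by linarith
  calc r * Y / (ρ * X) ≤ δ * X * Y / (ρ * X) := by gcongr
    _ = δ / ρ * Y * (X / X) := by ring
    _ ≤ δ / ρ * Y := mul_le_of_le_one_right (by positivity) (div_self_le_one X)
    _ ≤ δ / (3 * d) * Y := by gcongr

theorem norm_noisyPreact_succ_sub_le (hρ : 3 * (d : ℝ) ≤ ρ) (hγ : 0 ≤ γ) (hδ : 0 ≤ δ)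
    (hsmooth : ω ∈ smoothEvent p θ S ρ) {n k : ℕ} (hn : 1 ≤ n) (hk : n + 1 + k ≤ d) (hz : z ∈ S)
    (ht : t ∈ Icc (0 : ℝ) 1)
    (hnoise : ‖noisyPreact p θ ω (n + 1) t z.1 (n + 1) - noisyPreact p θ ω n t z.1 (n + 1)‖ ≤
      γ * minInterlayerCushion θ S (n + 1) * ‖preact θ z.1 (n + 1)‖)
    (hclose : ‖noisyPreact p θ ω (n + 1) t z.1 (n + 1) - preact θ z.1 (n + 1)‖ ≤
      δ * ‖preact θ z.1 (n + 1)‖) :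
    ‖noisyPreact p θ ω (n + 1) t z.1 (n + 1 + k) - noisyPreact p θ ω n t z.1 (n + 1 + k)‖ ≤
      (γ + (2 * δ + γ) / (3 * d)) * ‖preact θ z.1 (n + 1 + k)‖ := by
  obtain ⟨hsmooth_succ, hsmooth_self⟩ := hsmooth (n + 1) k (by omega) hk z hz t ht
  rw [Nat.add_sub_cancel] at hsmooth_self
  rw [noisyPreact_eq_layers p θ ω t z.1 n.succ_pos le_rfl,
    noisyPreact_eq_layers p θ ω t z.1 n.succ_pos n.le_succ]
  have hJ := minInterlayerCushion_mul_le (θ := θ) hz n.succ_pos hk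
  have hμ : minInterlayerCushion θ S (n + 1) ≤ 1 :=
    minInterlayerCushion_le_one ⟨z, hz⟩ (by omega)
  set u := noisyPreact p θ ω (n + 1) t z.1 (n + 1)
  set w := noisyPreact p θ ω n t z.1 (n + 1)
  set J := jacobian θ z.1 (n + 1) k
  set X := ‖preact θ z.1 (n + 1)‖
  set Y := ‖preact θ z.1 (n + 1 + k)‖
  set μ := minInterlayerCushion θ S (n + 1)
  have hX : 0 ≤ X := norm_nonneg _
  have hY : 0 ≤ Y := norm_nonneg _
  have hclose_self : ‖w - preact θ z.1 (n + 1)‖ ≤ (δ + γ) * X := by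
    have htriangle := norm_sub_le_norm_sub_add_norm_sub w u (preact θ z.1 (n + 1))
    have hγμ : γ * μ * X ≤ γ * 1 * X := by gcongr
    rw [norm_sub_rev w u] at htriangle
    linarith
  have hlin : ‖J‖ * ‖u - w‖ ≤ γ * Y := calc
    ‖J‖ * ‖u - w‖ ≤ ‖J‖ * (γ * μ * X) := by gcongr
    _ = γ * (μ * (‖J‖ * X)) := by ring
    _ ≤ γ * Y := by gcongr
  calc ‖layers θ (n + 1) k u - layers θ (n + 1) k w‖
      ≤ δ / (3 * d) * Y + (δ + γ) / (3 * d) * Y + γ * Y :=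
        (norm_map_sub_map_le_of_linear _ J u w).trans <| add_le_add (add_le_add
          (hsmooth_succ.trans (smoothnessBound_le hρ (by omega) hδ hX hY hclose))
          (hsmooth_self.trans
            (smoothnessBound_le hρ (by omega) (by positivity) hX hY hclose_self))) hlin
    _ = (γ + (2 * δ + γ) / (3 * d)) * Y := by ring

theorem norm_noisyPreact_sub_le_of_forall_step {q : ℝ} (hq : 0 ≤ q) (x : Vec (h 0)) {j : ℕ}
    (hj : 1 ≤ j) (hjd : j ≤ d)
    (hstep : ∀ n, 1 ≤ n → n < j →
      ‖noisyPreact p θ ω (n + 1) t x j - noisyPreact p θ ω n t x j‖ ≤ q * ‖preact θ x j‖) :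
    ‖noisyPreact p θ ω j t x j - preact θ x j‖ ≤ d * q * ‖preact θ x j‖ := by
  have htelescope : noisyPreact p θ ω j t x j - preact θ x j =
      ∑ n ∈ Finset.Ico 1 j, (noisyPreact p θ ω (n + 1) t x j - noisyPreact p θ ω n t x j) := by
    rw [Finset.sum_Ico_sub (fun n => noisyPreact p θ ω n t x j) hj, noisyPreact_one]
  have hcard : ((j - 1 : ℕ) : ℝ) ≤ d := by exact_mod_cast (by omega : j - 1 ≤ d)
  rw [htelescope]
  calc ‖∑ n ∈ Finset.Ico 1 j, (noisyPreact p θ ω (n + 1) t x j - noisyPreact p θ ω n t x j)‖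
      ≤ (j - 1 : ℕ) * (q * ‖preact θ x j‖) := by
        rw [← Nat.card_Ico, ← nsmul_eq_mul]
        exact (norm_sum_le _ _).trans <| Finset.sum_le_card_nsmul _ _ _ fun n hn =>
          hstep n (Finset.mem_Ico.1 hn).1 (Finset.mem_Ico.1 hn).2
    _ ≤ d * (q * ‖preact θ x j‖) := by gcongr
    _ = d * q * ‖preact θ x j‖ := by ring

/-- By induction on the layer: as long as the noise below layer `j` stays small, so does the total
noise at layer `j`, to which each lower layer contributes about equally. -/
theorem norm_noisyPreact_sub_le (hc : 0 < minCushion θ S) (hd : 2 ≤ d) (hK : 0 ≤ K) (hΛ : 0 ≤ Λ)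
    (hsmall : 4 * d * relNoise K Λ θ S ≤ 1) (hρ : 3 * (d : ℝ) ≤ ρ)
    (hsmooth : ω ∈ smoothEvent p θ S ρ) (hspread : ω ∈ spreadEvent p θ S K) (hz : z ∈ S)
    (hquiet : ∀ n (hnd : n < d), 1 ≤ n → ω ∉ noisyEvent p θ hnd z.1 (actBound K θ n z.1) Λ)
    {j : ℕ} (hj : 1 ≤ j) (hjd : j ≤ d) (ht : t ∈ Icc (0 : ℝ) 1) :
    ‖noisyPreact p θ ω j t z.1 j - preact θ z.1 j‖ ≤
      4 * d * relNoise K Λ θ S * ‖preact θ z.1 j‖ := by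
  induction j using Nat.strong_induction_on generalizing t with
  | _ j ih =>
  have hstep : ∀ n, 1 ≤ n → n < j →
      ‖noisyPreact p θ ω (n + 1) t z.1 (n + 1) - noisyPreact p θ ω n t z.1 (n + 1)‖ ≤
        relNoise K Λ θ S * minInterlayerCushion θ S (n + 1) * ‖preact θ z.1 (n + 1)‖ :=
    fun n hn hnj => norm_noisyPreact_succ_sub_le_of_notMem hc hK hΛ hspread hz hn (by omega)
      (hquiet n (by omega) hn) (fun t ht => (ih n hnj hn (by omega) ht).trans
        (mul_le_of_le_one_left (norm_nonneg _) hsmall)) ht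
  have hγ : 0 ≤ relNoise K Λ θ S := relNoise_nonneg hK hΛ
  set γ := relNoise K Λ θ S
  have hd₀ : (2 : ℝ) ≤ d := by exact_mod_cast hd
  have hq : 0 ≤ (2 * (4 * d * γ) + γ) / (3 * d) := by positivity
  refine (norm_noisyPreact_sub_le_of_forall_step (q := γ + (2 * (4 * d * γ) + γ) / (3 * d))
    (by positivity) z.1 hj hjd fun n hn hnj => ?_).trans ?_
  · rcases (Nat.succ_le_of_lt hnj).eq_or_lt with rfl | hlt
    · have hμ : minInterlayerCushion θ S (n + 1) ≤ 1 := minInterlayerCushion_le_one ⟨z, hz⟩ hjd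
      refine (hstep n hn hnj).trans ?_
      gcongr
      exact (mul_le_of_le_one_right hγ hμ).trans (le_add_of_nonneg_right hq)
    · obtain ⟨k, rfl⟩ := Nat.exists_eq_add_of_le hlt.le
      exact norm_noisyPreact_succ_sub_le hρ hγ (by positivity) hsmooth hn hjd hz ht
        (hstep n hn hnj) (ih (n + 1) hlt (by omega) (by omega) ht)
  · refine mul_le_mul_of_nonneg_right ?_ (norm_nonneg _)
    calc d * (γ + (2 * (4 * d * γ) + γ) / (3 * d)) = d * γ + 8 / 3 * d * γ + γ / 3 := by
          field_simp
          ring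
      _ ≤ 4 * d * γ := by nlinarith

end Propagation

/-! ### Replacing a noise stable network by one that uses half of its units -/

section Sizes

/-- The number whose logarithm is the logarithmic factor. -/
def sizeNumber (d : ℕ) (h : ℕ → ℕ) (N : ℕ) : ℕ := 2 + N + d + ∑ i ∈ Finset.Icc 1 d, h i

theorem logFactor_eq_log_sizeNumber (N : ℕ) :
    logFactor d h N = Real.log (sizeNumber d h N) := by
  unfold logFactor sizeNumber
  push_cast
  rfl

theorem two_add_le_sizeNumber (N : ℕ) : 2 + N + d ≤ sizeNumber d h N := Nat.le_add_right _ _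

theorem add_width_le_sizeNumber (N : ℕ) {n : ℕ} (hn : 1 ≤ n) (hnd : n ≤ d) :
    2 + d + h n ≤ sizeNumber d h N := by
  have := Finset.single_le_sum (f := h) (fun _ _ => Nat.zero_le _) (Finset.mem_Icc.2 ⟨hn, hnd⟩)
  unfold sizeNumber
  omega

theorem one_le_logFactor (hd : 2 ≤ d) (N : ℕ) : 1 ≤ logFactor d h N := by
  have hsize : (4 : ℝ) ≤ sizeNumber d h N := by
    exact_mod_cast (by omega : 4 ≤ 2 + N + d).trans (two_add_le_sizeNumber N)
  rw [logFactor_eq_log_sizeNumber, Real.le_log_iff_exp_le (by linarith)]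
  linarith [Real.exp_one_lt_d9]

theorem exp_neg_mul_logFactor (N k : ℕ) :
    Real.exp (-(k * logFactor d h N)) = ((sizeNumber d h N : ℝ) ^ k)⁻¹ := by
  have hsize : 0 < sizeNumber d h N := by unfold sizeNumber; omega
  rw [logFactor_eq_log_sizeNumber, Real.exp_neg, ← Real.log_pow, Real.exp_log (by positivity)]

/-- How many times its scale the noise of a unit may reach. It makes the sub-Gaussian tail beat the
union bound over the sample, the units, and the net. -/
def deviation (d : ℕ) (h : ℕ → ℕ) (N : ℕ) : ℝ := Real.sqrt (80 * d * logFactor d h N)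

theorem deviation_nonneg (N : ℕ) : 0 ≤ deviation d h N := Real.sqrt_nonneg _

theorem sq_deviation (N : ℕ) : deviation d h N ^ 2 = 80 * d * logFactor d h N := by
  have hL : 0 ≤ logFactor d h N := by
    rw [logFactor_eq_log_sizeNumber]
    exact Real.log_natCast_nonneg _
  exact Real.sq_sqrt (by positivity)

theorem deviation_add_four_le (hd : 2 ≤ d) (N : ℕ) :
    deviation d h N + 4 ≤ 13 * (Real.sqrt d * logFactor d h N) := by
  have hL := one_le_logFactor (h := h) hd N
  have hsqrt : 1 ≤ Real.sqrt d := Real.one_le_sqrt.2 (by exact_mod_cast (by omega : 1 ≤ d))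
  have hdev : deviation d h N ≤ 9 * (Real.sqrt d * logFactor d h N) := by
    refine Real.sqrt_le_iff.2 ⟨by positivity, ?_⟩
    calc 80 * d * logFactor d h N ≤ 81 * d * (logFactor d h N * logFactor d h N) := by
          gcongr
          · norm_num
          · exact le_mul_of_one_le_left (by positivity) hL
      _ = (9 * (Real.sqrt d * logFactor d h N)) ^ 2 := by
          rw [mul_pow, mul_pow, Real.sq_sqrt (Nat.cast_nonneg d)]
          ring
  linarith [one_le_mul_of_one_le_of_one_le hsqrt hL]

theorem logFactor_le_width (hd : 2 ≤ d) {N : ℕ}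
    (H : 8 * d * deviation d h N ≤ Real.sqrt (minWidth d h)) {n : ℕ} (hn : 1 ≤ n) (hnd : n < d) :
    24 * logFactor d h N ≤ h n := by
  have hL := one_le_logFactor (h := h) hd N
  have hd' : (2 : ℝ) ≤ d := by exact_mod_cast hd
  calc 24 * logFactor d h N ≤ 24 * (d ^ 3 * logFactor d h N) := by
        gcongr
        exact le_mul_of_one_le_left (by positivity) (one_le_pow₀ (by linarith))
    _ ≤ 64 * 80 * (d ^ 3 * logFactor d h N) := by gcongr; norm_num
    _ = (8 * d * deviation d h N) ^ 2 := by
        rw [mul_pow, sq_deviation]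
        ring
    _ ≤ Real.sqrt (minWidth d h) ^ 2 := by
        gcongr
        exact mul_nonneg (by positivity) (deviation_nonneg N)
    _ = minWidth d h := Real.sq_sqrt (Nat.cast_nonneg _)
    _ ≤ h n := by exact_mod_cast minWidth_le hn hnd

end Sizes

/-- The dropout probability `3 / 4`, for which half of the units is twice the expected number of
survivors. -/
def dropProb : unitInterval := ⟨3 / 4, by norm_num, by norm_num⟩

section DropProb

variable {S : Finset (Vec (h 0) × Vec (h d))}

theorem coe_dropProb : (dropProb : ℝ) = 3 / 4 := rfl

theorem dropProb_lt_one : (dropProb : ℝ) < 1 := by norm_num [coe_dropProb]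

theorem dropoutLaw_crowdedEvent_le_inv_pow {N n : ℕ} (hn : 1 ≤ n) (hnd : n < d)
    (hwidth : 24 * logFactor d h N ≤ h n) :
    (dropoutLaw d h dropProb).real (crowdedEvent d h dropProb n) ≤
      ((sizeNumber d h N : ℝ) ^ 3)⁻¹ := by
  refine (dropoutLaw_crowdedEvent_le dropProb_lt_one hn hnd).trans ?_
  rw [← exp_neg_mul_logFactor, coe_dropProb, Real.exp_le_exp]
  push_cast
  linarith

theorem dropoutLaw_noisyEvent_le_inv_pow (θ : Params d h) (x : Vec (h 0)) (N : ℕ) {n : ℕ}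
    (hn : 1 ≤ n) (hnd : n < d) (hh : 0 < h n) {B : ℝ} (hB : 0 < B) :
    (dropoutLaw d h dropProb).real (noisyEvent dropProb θ hnd x B (deviation d h N + 4)) ≤
      2 * ((sizeNumber d h N : ℝ) ^ 4)⁻¹ := by
  have hM : (1 : ℝ) ≤ sizeNumber d h N := by
    exact_mod_cast (by omega : 1 ≤ 2 + N + d).trans (two_add_le_sizeNumber N)
  have htail : Real.exp (-2 * ((1 - dropProb) * deviation d h N) ^ 2) =
      ((sizeNumber d h N : ℝ) ^ (10 * d))⁻¹ := by
    rw [← exp_neg_mul_logFactor, mul_pow, sq_deviation, coe_dropProb]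
    push_cast
    ring_nf
  have hnext : (h (n + 1) : ℝ) ≤ sizeNumber d h N := by
    exact_mod_cast (Nat.le_add_left _ _).trans (add_width_le_sizeNumber N n.succ_pos hnd)
  have hnet : (netSize h n : ℝ) ≤ (sizeNumber d h N : ℝ) ^ (2 * n + 1) := by
    refine mod_cast netSize_le_pow hn fun m hm hmn => ?_
    have := add_width_le_sizeNumber (h := h) N hm (by omega : m ≤ d)
    omega
  have hevent := dropoutLaw_noisyEvent_le dropProb_lt_one θ x hn hnd hh hB
    (deviation_nonneg (d := d) (h := h) N)
  rw [htail, (by norm_num [coe_dropProb] : (1 - (dropProb : ℝ))⁻¹ = 4)] at hevent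
  refine hevent.trans ?_
  set M := (sizeNumber d h N : ℝ)
  calc h (n + 1) * (netSize h n * (2 * (M ^ (10 * d))⁻¹))
      ≤ M * (M ^ (2 * n + 1) * (2 * (M ^ (1 + (2 * n + 1) + 4))⁻¹)) := by
        gcongr
        · omega
    _ = 2 * (M ^ 4)⁻¹ := by
        have : 0 < M := by linarith
        field_simp
        ring

theorem dropoutLaw_crowdedEvent_union_noisyEvent_le (θ : Params d h) {n : ℕ} (hn : 1 ≤ n)
    (hnd : n < d) (hwidth : 24 * logFactor d h S.card ≤ h n) {B : Vec (h 0) → ℝ}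
    (hB : ∀ z ∈ S, 0 < B z.1) :
    (dropoutLaw d h dropProb).real (crowdedEvent d h dropProb n ∪
      ⋃ z ∈ S, noisyEvent dropProb θ hnd z.1 (B z.1) (deviation d h S.card + 4)) ≤
      3 * ((sizeNumber d h S.card : ℝ) ^ 3)⁻¹ := by
  have hh : 0 < h n := by
    have := one_le_logFactor (h := h) (by omega : 2 ≤ d) S.card
    exact_mod_cast (by linarith : (0 : ℝ) < h n)
  have hnoisy := measureReal_biUnion_finset_le_card_mul S fun z hz =>
    dropoutLaw_noisyEvent_le_inv_pow θ z.1 S.card hn hnd hh (hB z hz)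
  have hM : (0 : ℝ) < sizeNumber d h S.card := by
    exact_mod_cast (by omega : 0 < 2 + S.card + d).trans_le (two_add_le_sizeNumber _)
  have hcard : (S.card : ℝ) ≤ sizeNumber d h S.card := by
    exact_mod_cast (by omega : S.card ≤ 2 + S.card + d).trans (two_add_le_sizeNumber _)
  calc _ ≤ _ := (measureReal_union_le _ _).trans
        (add_le_add (dropoutLaw_crowdedEvent_le_inv_pow hn hnd hwidth) hnoisy)
    _ ≤ ((sizeNumber d h S.card : ℝ) ^ 3)⁻¹ +
        sizeNumber d h S.card * (2 * ((sizeNumber d h S.card : ℝ) ^ 4)⁻¹) := by gcongr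
    _ = 3 * ((sizeNumber d h S.card : ℝ) ^ 3)⁻¹ := by
        field_simp
        ring

theorem exists_mem_notMem_crowdedEvent_notMem_noisyEvent (hd : 2 ≤ d) (θ : Params d h)
    {E : Set (Mask d h)} (hE : 1 / 2 ≤ dropoutLaw d h dropProb E)
    (hwidth : ∀ n, 1 ≤ n → n < d → 24 * logFactor d h S.card ≤ h n) {B : ℕ → Vec (h 0) → ℝ}
    (hB : ∀ n, 1 ≤ n → n < d → ∀ z ∈ S, 0 < B n z.1) :
    ∃ ω ∈ E, (∀ n, 1 ≤ n → n < d → ω ∉ crowdedEvent d h dropProb n) ∧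
      ∀ z ∈ S, ∀ n (hnd : n < d), 1 ≤ n →
        ω ∉ noisyEvent dropProb θ hnd z.1 (B n z.1) (deviation d h S.card + 4) := by
  have hsize : (2 : ℝ) + d ≤ sizeNumber d h S.card := by
    exact_mod_cast (by omega : 2 + d ≤ 2 + S.card + d).trans (two_add_le_sizeNumber _)
  have hd' : (2 : ℝ) ≤ d := by exact_mod_cast hd
  have hfew : d * (3 * ((sizeNumber d h S.card : ℝ) ^ 3)⁻¹) < 1 / 2 := by
    have hM : (0 : ℝ) < sizeNumber d h S.card := by linarith
    rw [← mul_assoc, ← div_eq_mul_inv, div_lt_iff₀ (by positivity)]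
    nlinarith [mul_pos hM hM]
  obtain ⟨ω, hωE, hω⟩ := exists_mem_forall_notMem_of_half_le hE (by positivity) hfew
    fun n hn => dropoutLaw_crowdedEvent_union_noisyEvent_le θ hn n.2 (hwidth n hn n.2)
      (hB n hn n.2)
  simp only [mem_union, mem_iUnion, not_or, not_exists] at hω
  exact ⟨ω, hωE, fun n hn hnd => (hω ⟨n, hnd⟩ hn).1,
    fun z hz n hnd hn => (hω ⟨n, hnd⟩ hn).2 z hz⟩

end DropProb

theorem isSupportedOn_dropout (p : unitInterval) (θ : Params d h) (ω : Mask d h) :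
    IsSupportedOn (dropout p θ ω d) (aliveUnits ω) := fun n hnd a _ b hb => by
  simp only [aliveUnits, mem_ofPred_eq, not_forall, Bool.not_eq_false] at hb
  obtain ⟨_, hn, hdropped⟩ := hb
  rw [weight_of_lt _ hnd, dropout, Matrix.of_apply, if_pos ⟨hn, hnd⟩, if_pos hdropped, zero_mul]

theorem isHalfSupportedOn_dropout {p : unitInterval} (hp : 3 / 4 ≤ (p : ℝ)) (θ : Params d h)
    {ω : Mask d h} (hω : ∀ n, 1 ≤ n → n < d → ω ∉ crowdedEvent d h p n) :
    IsHalfSupportedOn (dropout p θ ω d) (aliveUnits ω) where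
  isSupportedOn := isSupportedOn_dropout p θ ω
  last := eq_univ_of_forall fun _ hd => absurd hd d.lt_irrefl
  ncard_le n hn hnd := by
    have halive : ((aliveUnits ω n).ncard : ℝ) ≤ 2 * (1 - p) * h n := not_lt.1 (hω n hn hnd)
    have hhalf : 2 * (1 - (p : ℝ)) * h n ≤ 1 / 2 * h n := by
      gcongr
      linarith
    exact_mod_cast (by linarith : 2 * ((aliveUnits ω n).ncard : ℝ) ≤ h n)

theorem weight_replaceLast_zero_last (θ : Params d h) {n : ℕ} (hn : n + 1 = d) :
    weight (replaceLast θ 0) n = 0 := by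
  rw [weight_replaceLast, if_pos hn, weight_of_lt _ (by omega)]
  rfl

theorem isHalfSupportedOn_replaceLast_zero (θ : Params d h) :
    IsHalfSupportedOn (replaceLast θ 0) fun n => {_b | n = 0 ∨ d ≤ n} where
  isSupportedOn n hnd a ha b _ := by
    have hlast : n + 1 = d := (ha.resolve_left n.succ_ne_zero).antisymm' hnd
    rw [weight_replaceLast_zero_last θ hlast, Matrix.zero_apply]
  last := eq_univ_of_forall fun _ => Or.inr le_rfl
  ncard_le n hn hnd := by
    have hempty : ¬ (n = 0 ∨ d ≤ n) := by omega
    simp [hempty]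

theorem output_smul_add_smul_replaceLast_zero (hd : 0 < d) (θ : Params d h) {s t : ℝ}
    (hst : s + t = 1) (x : Vec (h 0)) :
    output (s • θ + t • replaceLast θ 0) x = s • output θ x := by
  have houtput : output (replaceLast θ 0) x = 0 := by
    obtain ⟨n, rfl⟩ := Nat.exists_eq_add_of_le' hd
    rw [output, preact_succ, weight_replaceLast_zero_last θ rfl]
    ext a
    simp [apply_coord]
  have hweight (n : ℕ) (hn : n + 1 < d) : weight θ n = weight (replaceLast θ 0) n := by
    rw [weight_replaceLast, if_neg hn.ne]
  rw [output_smul_add_smul_of_eq_below_last hweight hst, houtput, smul_zero, add_zero]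

section NoiseStable

variable {p : unitInterval} {θ : Params d h} {S : Finset (Vec (h 0) × Vec (h d))} {K Λ β ε : ℝ}

theorem spreadEvent_mono {K' : ℝ} (hK : K ≤ K') :
    spreadEvent p θ S K ⊆ spreadEvent p θ S K' := fun _ hω n hn hnd z hz t ht a =>
  (hω n hn hnd z hz t ht a).trans (by gcongr)

theorem norm_output_le_maxOutput {z : Vec (h 0) × Vec (h d)} (hz : z ∈ S) :
    ‖output θ z.1‖ ≤ maxOutput θ S :=
  le_ciSup (Set.finite_range fun z : S => ‖output θ z.1.1‖).bddAbove ⟨z, hz⟩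

theorem le_sqrt_minWidth_of_relNoise_le (hc : 0 < minCushion θ S) (hd : 2 ≤ d) (hS : S.Nonempty)
    (hK : 1 ≤ K) (hΛ : 0 ≤ Λ) (hsmall : 4 * d * relNoise K Λ θ S ≤ 1) :
    8 * d * Λ ≤ Real.sqrt (minWidth d h) := by
  have hwidth : 0 < Real.sqrt (minWidth d h) :=
    Real.sqrt_pos.2 (by exact_mod_cast minWidth_pos hc hd hS)
  have hcontraction := one_le_activationContraction hc hd hS
  have hcushion : minCushion θ S ≤ 1 := minCushion_le_one hd hS
  rw [← div_le_one hwidth]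
  calc 8 * d * Λ / Real.sqrt (minWidth d h)
      = 4 * d * (2 * Λ * 1 * 1 / (Real.sqrt (minWidth d h) * 1)) := by ring
    _ ≤ 4 * d * relNoise K Λ θ S := by
        unfold relNoise
        gcongr
    _ ≤ 1 := hsmall

theorem exists_dropout_norm_output_sub_le (hd : 2 ≤ d) (hS : S.Nonempty) (hK : 1 ≤ K)
    (hθ : IsNoiseStable dropProb K β S θ ε)
    (hsmall : 4 * d * relNoise K (deviation d h S.card + 4) θ S ≤ 1) :
    ∃ θ' U, IsHalfSupportedOn θ' U ∧ ∀ η ∈ segment ℝ θ θ', ∀ z ∈ S,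
      ‖output η z.1 - output θ z.1‖ ≤
        4 * d * relNoise K (deviation d h S.card + 4) θ S * ‖output θ z.1‖ := by
  obtain ⟨hc, ⟨ρ, hρ, hE⟩, -⟩ := hθ
  have hΛ : 0 ≤ deviation d h S.card := deviation_nonneg _
  have hwidth := le_sqrt_minWidth_of_relNoise_le hc hd hS hK (by linarith) hsmall
  have hB : ∀ n, 1 ≤ n → n < d → ∀ z ∈ S, 0 < actBound K θ n z.1 := fun n hn hnd z hz => by
    have := norm_preact_pos hc hd hz hn hnd.le
    have := width_pos hc hS hn hnd
    unfold actBound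
    positivity
  obtain ⟨ω, ⟨hsmooth, hspread⟩, hcrowded, hquiet⟩ :=
    exists_mem_notMem_crowdedEvent_notMem_noisyEvent hd θ hE
      (fun n hn hnd => logFactor_le_width hd
        (le_trans (by gcongr; linarith) hwidth) hn hnd) hB
  refine ⟨_, _, isHalfSupportedOn_dropout (by norm_num [coe_dropProb]) θ hcrowded, ?_⟩
  rintro _ ⟨s, t, hs, ht, hst, rfl⟩ z hz
  obtain rfl : t = 1 - s := by linarith
  exact norm_noisyPreact_sub_le hc hd (by linarith) (by linarith) hsmall hρ hsmooth hspread hz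
    (hquiet z hz) (by omega) le_rfl ⟨hs, by linarith⟩

/-- If the noise of the dropout is not known to be small, then it is cheaper to delete the last
layer. -/
theorem exists_isHalfSupportedOn_norm_output_sub_le (hd : 2 ≤ d) (hS : S.Nonempty) (hK : 1 ≤ K)
    (hθ : IsNoiseStable dropProb K β S θ ε) :
    ∃ θ' U, IsHalfSupportedOn θ' U ∧ ∀ η ∈ segment ℝ θ θ', ∀ z ∈ S,
      ‖output η z.1 - output θ z.1‖ ≤
        4 * d * relNoise K (deviation d h S.card + 4) θ S * maxOutput θ S := by
  have hγ : 0 ≤ relNoise K (deviation d h S.card + 4) θ S :=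
    relNoise_nonneg (by linarith) (by linarith [deviation_nonneg (d := d) (h := h) S.card])
  rcases le_or_gt (4 * d * relNoise K (deviation d h S.card + 4) θ S) 1 with hsmall | hlarge
  · obtain ⟨θ', U, hU, H⟩ := exists_dropout_norm_output_sub_le hd hS hK hθ hsmall
    refine ⟨θ', U, hU, fun η hη z hz => (H η hη z hz).trans ?_⟩
    gcongr
    exact norm_output_le_maxOutput hz
  · refine ⟨_, _, isHalfSupportedOn_replaceLast_zero θ, ?_⟩
    rintro _ ⟨s, t, hs, ht, hst, rfl⟩ z hz
    have hdiff : s • output θ z.1 - output θ z.1 = -t • output θ z.1 := by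
      rw [eq_sub_of_add_eq hst]
      module
    rw [output_smul_add_smul_replaceLast_zero (by omega) θ hst, hdiff, norm_smul, norm_neg,
      Real.norm_of_nonneg ht]
    gcongr
    · linarith
    · exact norm_output_le_maxOutput hz

theorem mul_relNoise_mul_maxOutput_le (hd : 2 ≤ d) (hβ : 0 ≤ β) (hK : 0 ≤ K) :
    β * (4 * d * relNoise K (deviation d h S.card + 4) θ S * maxOutput θ S) ≤
      104 * K * logFactor d h S.card * noiseLevel β θ S := by
  have hF : 0 ≤ maxOutput θ S := Real.iSup_nonneg fun _ => norm_nonneg _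
  have hc : 0 ≤ activationContraction θ S := activationContraction_nonneg
  have hμ : 0 ≤ minCushion θ S := minCushion_nonneg
  have hpow : (d : ℝ) ^ (3 / 2 : ℝ) = d * Real.sqrt d := by
    rw [Real.sqrt_eq_rpow, ← Real.rpow_one_add' (Nat.cast_nonneg d) (by norm_num)]
    norm_num
  calc β * (4 * d * relNoise K (deviation d h S.card + 4) θ S * maxOutput θ S)
      = (deviation d h S.card + 4) * (8 * d * K * β * activationContraction θ S *
          maxOutput θ S / (Real.sqrt (minWidth d h) * minCushion θ S)) := by
        rw [relNoise]
        ring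
    _ ≤ 13 * (Real.sqrt d * logFactor d h S.card) * (8 * d * K * β *
          activationContraction θ S * maxOutput θ S /
            (Real.sqrt (minWidth d h) * minCushion θ S)) := by
        gcongr
        exact deviation_add_four_le hd _
    _ = 104 * K * logFactor d h S.card * noiseLevel β θ S := by
        rw [noiseLevel, hpow]
        ring

theorem nonneg_of_abs_sub_le_mul_norm {E : Type*} [NormedAddCommGroup E] {f : E → ℝ}
    (hf : ∀ u v, |f u - f v| ≤ β * ‖u - v‖) {v : E} (hv : 0 < ‖v‖) : 0 ≤ β := by
  have := (abs_nonneg _).trans (hf v 0)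
  rw [sub_zero] at this
  exact nonneg_of_mul_nonneg_left this hv

theorem IsNoiseStable.mono {K' : ℝ} (hK : K ≤ K') (hθ : IsNoiseStable p K β S θ ε) :
    IsNoiseStable p K' β S θ ε where
  cushion_pos := hθ.cushion_pos
  smooth := hθ.smooth.imp fun _ H =>
    ⟨H.1, H.2.trans (measure_mono (inter_subset_inter_right _ (spreadEvent_mono hK)))⟩
  level_le := hθ.level_le

theorem IsNoiseStable.exists_isHalfSupportedOn (hθ : IsNoiseStable dropProb K β S θ ε)
    (hd : 2 ≤ d) (hS : S.Nonempty) {l : Vec (h d) → Vec (h d) → ℝ}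
    (hl : ∀ y u v, |l y u - l y v| ≤ β * ‖u - v‖) :
    ∃ θ' U, IsHalfSupportedOn θ' U ∧ segment ℝ θ θ' ⊆
      lossSublevel l S (loss l S θ + 104 * max K 1 * logFactor d h S.card * ε) := by
  obtain ⟨θ', U, hU, H⟩ := exists_isHalfSupportedOn_norm_output_sub_le hd hS
    (le_max_right K 1) (hθ.mono (le_max_left K 1))
  have hβ : 0 ≤ β := by
    obtain ⟨z, hz⟩ := hS
    exact nonneg_of_abs_sub_le_mul_norm (hl 0)
      (norm_preact_pos hθ.cushion_pos hd hz (by omega) le_rfl)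
  have hL := one_le_logFactor (h := h) hd S.card
  have hK : 0 ≤ max K 1 := zero_le_one.trans (le_max_right K 1)
  refine ⟨θ', U, hU, fun η hη => (loss_le_add_of_norm_output_sub_le hS hβ hl (H η hη)).trans
    (add_le_add le_rfl ((mul_relNoise_mul_maxOutput_le hd hβ hK).trans ?_))⟩
  gcongr
  exact hθ.level_le

theorem IsNoiseStable.joinedBySegments (hd : 2 ≤ d) (hS : S.Nonempty)
    {l : Vec (h d) → Vec (h d) → ℝ} (hconv : ∀ y, ConvexOn ℝ univ (l y))
    (hlip : ∀ y u v, |l y u - l y v| ≤ β * ‖u - v‖) {θA θB : Params d h}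
    (hA : IsNoiseStable dropProb K β S θA ε) (hB : IsNoiseStable dropProb K β S θB ε) :
    JoinedBySegments (lossSublevel l S (max (loss l S θA) (loss l S θB) +
      104 * max K 1 * logFactor d h S.card * ε)) 7 θA θB := by
  obtain ⟨A, U, hU, hθA⟩ := hA.exists_isHalfSupportedOn hd hS hlip
  obtain ⟨B, V, hV, hθB⟩ := hB.exists_isHalfSupportedOn hd hS hlip
  have hsegA := hθA.trans (lossSublevel_mono (add_le_add_left (le_max_left _ (loss l S θB)) _))
  have hsegB := hθB.trans (lossSublevel_mono (add_le_add_left (le_max_right (loss l S θA) _) _))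
  have toA := JoinedBySegments.of_segment_subset hsegA
  have AtoB := hU.joinedBySegments hconv hV (hsegA (right_mem_segment ..))
    (hsegB (right_mem_segment ..))
  have fromB := JoinedBySegments.of_segment_subset (segment_symm ℝ θB B ▸ hsegB)
  exact (toA.trans AtoB).trans fromB

end NoiseStable

end NoiseStability

end

theorem theorem2 :
    ∃ k : ℕ, ∀ K : ℝ, ∃ C : ℝ,
      ∀ (d : ℕ) (_ : 2 ≤ d) (h : ℕ → ℕ)
        (S : Finset (NoiseStability.Vec (h 0) × NoiseStability.Vec (h d))) (_ : S.Nonempty)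
        (β : ℝ) (l : NoiseStability.Vec (h d) → NoiseStability.Vec (h d) → ℝ)
        (_ : ∀ y, ConvexOn ℝ Set.univ (l y))
        (_ : ∀ y u v, |l y u - l y v| ≤ β * ‖u - v‖)
        (θA θB : NoiseStability.Params d h) (ε : ℝ)
        (_ : NoiseStability.IsNoiseStable ⟨3 / 4, by norm_num, by norm_num⟩ K β S θA ε)
        (_ : NoiseStability.IsNoiseStable ⟨3 / 4, by norm_num, by norm_num⟩ K β S θB ε),
        ∃ π : ℝ → NoiseStability.Params d h,
          NoiseStability.IsPolygonalPath 10 π θA θB ∧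
          ∀ t ∈ Set.Icc (0 : ℝ) 1,
            NoiseStability.loss l S (π t) ≤
              max (NoiseStability.loss l S θA) (NoiseStability.loss l S θB)
                + C * NoiseStability.logFactor d h S.card ^ k * ε := by
  refine ⟨1, fun K => ⟨104 * max K 1, fun d hd h S hS β l hconv hlip θA θB ε hA hB => ?_⟩⟩
  have joined := hA.joinedBySegments hd hS hconv hlip hB
  have padded := joined.trans (.refl (joined.right_mem (by norm_num)) 3)
  simpa only [pow_one] using! padded.exists_isPolygonalPath (by norm_num)
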